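/- Let $0<p<1$. Let $X_1,X_2,\dots$ be i.i.d. random variables, uniformly distributed on $[0,1]$, and let $N$ be a random horizon, independent of $(X_n)_{n\ge1}$, with $P(N=k)=p(1-p)^{k-1}$, $k\ge 1$. Object $n$ is available iff $n\le N$ and has value $X_n$. The relative rank of object $j$ among the objects $1,\dots,n$ is $1+\#\{1\le i\le n: X_i>X_j\}$; an object $n$ is relatively best (second best) if its relative rank among $1,\dots,n$ is $1$ (is $2$). If one stops at a time $n\le N$ at which object $n$ is relatively best or second best, one holds object $n$ until time $T_n\wedge N$, where $T_n$ is the first time $m>n$ at which the relative rank of object $n$ among $1,\dots,m$ exceeds $2$, and receives the duration $T_n\wedge N-n$; in all other cases (also if one never stops) one receives $0$. Strategies are the stopping times $\tau$ with values in $\{1,2,\dots\}\cup\{\infty\}$ of the filtration $\mathcal F_n=\sigma(X_1,\dots,X_n,\mathbf 1_{\{N\ge 1\}},\dots,\mathbf 1_{\{N\ge n\}})$, and the aim is to maximize the expected duration. There is exactly one $\mu>1$ with $\mu^2e^{2/\mu}=e^3$. With this $\mu$ let $$x^\star=\max\Bigl(0,\frac{\mu p-1}{p-1}\Bigr),\qquad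 \tau^\star=\inf\{n\ge1:\ X_n=\max(X_1,\dots,X_n),\ X_n>x^\star\}.$$ Then: 1. $\tau^\star$ is optimal among all strategies (stopping on relatively best and on relatively second best objects being allowed). It is essentially the only optimal strategy: if $\tau$ is optimal, then almost surely $\tau=\tau^\star$ whenever $\tau\le N$ or $\tau^\star\le N$. Thus an optimal strategy stops, within the horizon, only at a relative maximum exceeding the fixed value $x^\star$, whatever the second largest value is. 2. $\tau^\star$ depends only on the running maxima: $\{\tau^\star\le n\}\in\sigma\bigl(\max(X_1,\dots,X_k):1\le k\le n\bigr)$ for every $n$. 3. The problem reduces to the Kurushima–Ano problem with geometric horizon, i.e. to the same problem with strategies restricted to those that stop only at relatively best objects: $\tau^\star$ is also optimal in that restricted class, and the suprema of the expected duration over the two classes coincide. -/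

import Mathlib

open MeasureTheory ProbabilityTheory

namespace BestTwoDuration

noncomputable section

/-! Objects are numbered `1, 2, 3, …`; `X n ω` is the value of the `n`-th object (`X 0` is never
used), and `N ω` is the number of objects that are actually available (the horizon). -/

/-- Relative rank of object `j` among the objects `1, …, n`: it is `1` iff `X j` is the largest of
`X 1, …, X n`, and at most `2` iff `X j` is the largest or the second largest of them. -/
def relRank {Ω : Type*} (X : ℕ → Ω → ℝ) (j n : ℕ) (ω : Ω) : ℕ :=
  1 + ((Finset.Icc 1 n).filter (fun i => X j ω < X i ω)).card

/-- The largest of the values `X 1, …, X n` (and `0` if `n = 0`). -/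
def runningMax {Ω : Type*} (X : ℕ → Ω → ℝ) (n : ℕ) (ω : Ω) : ℝ :=
  if h : (Finset.Icc 1 n).Nonempty then (Finset.Icc 1 n).sup' h (fun i => X i ω) else 0

/-- The information at time `n`: the values `X 1, …, X n` and the events `{j ≤ N}`, `j ≤ n`. -/
def infoFiltration {Ω : Type*} [mΩ : MeasurableSpace Ω] (X : ℕ → Ω → ℝ) (N : Ω → ℕ)
    (hX : ∀ n, 1 ≤ n → Measurable (X n)) (hN : Measurable N) : Filtration ℕ mΩ where
  seq n := (⨆ i ∈ Finset.Icc 1 n, MeasurableSpace.comap (X i) inferInstance) ⊔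
    MeasurableSpace.generateFrom {A : Set Ω | ∃ j ≤ n, A = {ω | j ≤ N ω}}
  mono' := by
    intro a b hab
    refine sup_le_sup ?_ (MeasurableSpace.generateFrom_mono ?_)
    · exact biSup_mono fun i hi => Finset.Icc_subset_Icc_right hab hi
    · rintro A ⟨j, hj, rfl⟩
      exact ⟨j, hj.trans hab, rfl⟩
  le' := by
    intro n
    refine sup_le (iSup₂_le fun i hi => ?_) (MeasurableSpace.generateFrom_le ?_)
    · exact (hX i (Finset.mem_Icc.1 hi).1).comap_le
    · rintro A ⟨j, _, rfl⟩
      exact hN measurableSet_Ici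

/-- `τ` is adapted to the running maxima alone: for every `n`, the event `{τ ≤ n}` belongs to the
σ-algebra generated by the maxima of the first `1, 2, …, n` values. -/
def DependsOnMaximaOnly {Ω : Type*} (X : ℕ → Ω → ℝ) (τ : Ω → WithTop ℕ) : Prop :=
  ∀ n : ℕ, MeasurableSet[⨆ i ∈ Finset.Icc 1 n,
    MeasurableSpace.comap (runningMax X i) inferInstance] {ω | τ ω ≤ (n : WithTop ℕ)}

/-- The time at which object `n`, chosen at time `n`, has to be released: the first `m ≥ n` at
which the object is no longer among the two largest of the objects `1, …, m`, or the horizon `N` if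
that comes earlier. -/
def releaseTime {Ω : Type*} (X : ℕ → Ω → ℝ) (N : Ω → ℕ) (n : ℕ) (ω : Ω) : ℕ :=
  sInf {m : ℕ | n ≤ m ∧ (N ω ≤ m ∨ 2 < relRank X n m ω)}

/-- The duration collected by stopping at time `n`: zero if object `n` is not available or is
neither the relatively best nor the relatively second best at time `n`. -/
def duration {Ω : Type*} (X : ℕ → Ω → ℝ) (N : Ω → ℕ) (n : ℕ) (ω : Ω) : ℕ :=
  if 1 ≤ n ∧ n ≤ N ω ∧ relRank X n n ω ≤ 2 then releaseTime X N n ω - n else 0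

/-- The expected duration under the strategy `τ`; never stopping (`τ ω = ⊤`) yields nothing. -/
def expectedDuration {Ω : Type*} [MeasurableSpace Ω] (P : Measure Ω) (X : ℕ → Ω → ℝ) (N : Ω → ℕ)
    (τ : Ω → WithTop ℕ) : ENNReal :=
  ∫⁻ ω, (if τ ω = ⊤ then 0 else (duration X N ((τ ω).untopD 0) ω : ENNReal)) ∂P

/-- All strategies: the stopping times with values in `{1, 2, …} ∪ {∞}`. -/
def strategies {Ω : Type*} [MeasurableSpace Ω] (X : ℕ → Ω → ℝ) (N : Ω → ℕ)
    (hX : ∀ n, 1 ≤ n → Measurable (X n)) (hN : Measurable N) : Set (Ω → WithTop ℕ) :=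
  {τ | IsStoppingTime (infoFiltration X N hX hN) τ ∧ ∀ ω, 1 ≤ τ ω}

/-- The strategies that stop only at relatively best objects. -/
def bestOnlyStrategies {Ω : Type*} [MeasurableSpace Ω] (X : ℕ → Ω → ℝ) (N : Ω → ℕ)
    (hX : ∀ n, 1 ≤ n → Measurable (X n)) (hN : Measurable N) : Set (Ω → WithTop ℕ) :=
  {τ | τ ∈ strategies X N hX hN ∧ ∀ (ω : Ω) (n : ℕ), τ ω = (n : WithTop ℕ) → relRank X n n ω = 1}

/-- `τ` maximizes the expected duration in the class `𝒯`. -/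
def IsOptimal {Ω : Type*} [MeasurableSpace Ω] (P : Measure Ω) (X : ℕ → Ω → ℝ) (N : Ω → ℕ)
    (𝒯 : Set (Ω → WithTop ℕ)) (τ : Ω → WithTop ℕ) : Prop :=
  τ ∈ 𝒯 ∧ ∀ σ ∈ 𝒯, expectedDuration P X N σ ≤ expectedDuration P X N τ

open Classical in
/-- Stop at the first relatively best object whose value exceeds `c`. -/
def thresholdTime {Ω : Type*} (X : ℕ → Ω → ℝ) (c : ℝ) (ω : Ω) : WithTop ℕ :=
  if ∃ n : ℕ, 1 ≤ n ∧ relRank X n n ω = 1 ∧ c < X n ω then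
    ((sInf {n : ℕ | 1 ≤ n ∧ relRank X n n ω = 1 ∧ c < X n ω} : ℕ) : WithTop ℕ)
  else ⊤

/-- The threshold `max (0, (μ p - 1) / (p - 1))`. -/
def threshold (μ p : ℝ) : ℝ := max 0 ((μ * p - 1) / (p - 1))

end

end BestTwoDuration

open BestTwoDuration

/-! The horizon is memoryless and the values are uniform. On `n ≤ N`, the future therefore depends
on the past only through the object held and, before stopping, through the running maximum.
Conditioning on the next object (`holdValue_recursion`) gives the value of a held object: with `u =
1 - (1 - p) * x` it is `(1 - p) / u` at rank 2 and `(1 - p) * (2 / u - p / u ^ 2)` at rank 1.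

The candidate for the optimal value at running maximum `x` is `V x = bestValue p (max x s)`, with
`s` the threshold. For `x ≥ s`, its excess over waiting one step is `(1 - p) * (3 - 2 * (log r +
r⁻¹))`, where `r = u / p ≥ 1` (`optValue_sub_waitValue`). Since `log r + r⁻¹` increases on `r ≥ 1`,
and the equation for `μ` says that it equals `3 / 2` at `μ`, stopping is strictly better above `s`.
When `s > 0`, its ratio is exactly `μ`; below `s` the function `V` is constant and waiting attains
it. Stopping never yields more than `V`, and strictly less at a second best object.

The verification is an exact balance (`optimal_eq_expectedDuration_add`): the expectation of `V` at
the first maximum is the expected duration of any strategy plus nonnegative losses from stopping and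
from waiting. The threshold rule has no loss, hence is optimal. Conversely an optimal strategy has
no loss almost surely, which fixes its decisions within the horizon (`ae_eq_thresholdTime`). The
rule stops only at relative maxima, so the restricted problem has the same value. -/

namespace BestTwoDuration

/-! ### Ranks, running maxima and threshold times along a path -/

section Pathwise

variable {Ω : Type*} (X : ℕ → Ω → ℝ) (N : Ω → ℕ)

lemma one_le_relRank (j n : ℕ) (ω : Ω) : 1 ≤ relRank X j n ω := Nat.le_add_right 1 _

lemma relRank_succ (j n : ℕ) (ω : Ω) :
    relRank X j (n + 1) ω = relRank X j n ω + if X j ω < X (n + 1) ω then 1 else 0 := by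
  have h : Finset.Icc 1 (n + 1) = insert (n + 1) (Finset.Icc 1 n) := by
    ext i; simp only [Finset.mem_Icc, Finset.mem_insert]; omega
  unfold relRank
  rw [h, Finset.filter_insert]
  split_ifs with hlt
  · rw [Finset.card_insert_of_notMem (by simp)]; ring
  · simp

lemma relRank_mono (j : ℕ) (ω : Ω) : Monotone fun n => relRank X j n ω :=
  monotone_nat_of_le_succ fun n => by rw [relRank_succ]; exact Nat.le_add_right _ _

lemma relRank_eq_one_iff {j n : ℕ} {ω : Ω} :
    relRank X j n ω = 1 ↔ ∀ i, 1 ≤ i → i ≤ n → X i ω ≤ X j ω := by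
  unfold relRank
  simp [Finset.card_eq_zero, Finset.filter_eq_empty_iff]

lemma runningMax_of_pos {n : ℕ} (hn : 1 ≤ n) (ω : Ω) :
    runningMax X n ω =
      (Finset.Icc 1 n).sup' (Finset.nonempty_Icc.2 hn) (fun i => X i ω) := by
  unfold runningMax
  rw [dif_pos (Finset.nonempty_Icc.2 hn)]

lemma runningMax_one (ω : Ω) : runningMax X 1 ω = X 1 ω := by
  rw [runningMax_of_pos X le_rfl]; simp

lemma le_runningMax {i n : ℕ} (hi : 1 ≤ i) (hin : i ≤ n) (ω : Ω) :
    X i ω ≤ runningMax X n ω := by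
  rw [runningMax_of_pos X (hi.trans hin)]
  exact Finset.le_sup' (fun i => X i ω) (Finset.mem_Icc.2 ⟨hi, hin⟩)

lemma exists_eq_runningMax {n : ℕ} (hn : 1 ≤ n) (ω : Ω) :
    ∃ i, 1 ≤ i ∧ i ≤ n ∧ runningMax X n ω = X i ω := by
  rw [runningMax_of_pos X hn]
  obtain ⟨i, hi, h⟩ := Finset.exists_mem_eq_sup' (Finset.nonempty_Icc.2 hn) (fun i => X i ω)
  exact ⟨i, (Finset.mem_Icc.1 hi).1, (Finset.mem_Icc.1 hi).2, h⟩

lemma runningMax_succ {n : ℕ} (hn : 1 ≤ n) (ω : Ω) :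
    runningMax X (n + 1) ω = max (runningMax X n ω) (X (n + 1) ω) := by
  apply le_antisymm
  · obtain ⟨i, h1, h2, h⟩ := exists_eq_runningMax X (n := n + 1) (by omega) ω
    rw [h]
    rcases Nat.lt_or_ge n i with h3 | h3
    · rw [show i = n + 1 by omega]; exact le_max_right _ _
    · exact (le_runningMax X h1 h3 ω).trans (le_max_left _ _)
  · apply max_le
    · obtain ⟨i, h1, h2, h⟩ := exists_eq_runningMax X hn ω
      rw [h]; exact le_runningMax X h1 (by omega) ω
    · exact le_runningMax X (by omega) le_rfl ω

lemma relRank_self_eq_one_iff {n : ℕ} (hn : 1 ≤ n) {ω : Ω} :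
    relRank X n n ω = 1 ↔ X n ω = runningMax X n ω := by
  rw [relRank_eq_one_iff]
  constructor
  · intro h
    obtain ⟨i, h1, h2, h3⟩ := exists_eq_runningMax X hn ω
    exact le_antisymm (le_runningMax X hn le_rfl ω) (h3 ▸ h i h1 h2)
  · intro h i h1 h2
    rw [h]; exact le_runningMax X h1 h2 ω

/-- The duration is the number of steps during which the held object is still among the two
largest and the horizon has not been reached. -/
lemma duration_eq_tsum {n : ℕ} (hn : 1 ≤ n) (ω : Ω) :
    (duration X N n ω : ENNReal) =
      ∑' k : ℕ, if n + k + 1 ≤ N ω ∧ relRank X n (n + k) ω ≤ 2 then 1 else 0 := by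
  unfold duration
  split_ifs with h
  · obtain ⟨_, hnN, hr⟩ := h
    set S : Set ℕ := {m : ℕ | n ≤ m ∧ (N ω ≤ m ∨ 2 < relRank X n m ω)} with hS
    have hne : S.Nonempty := ⟨N ω, hnN, Or.inl le_rfl⟩
    have hmem : releaseTime X N n ω ∈ S := Nat.sInf_mem hne
    have hle : n ≤ releaseTime X N n ω := hmem.1
    -- The unit earned between `n + k` and `n + k + 1` needs the horizon to reach `n + k + 1`, but
    -- the rank only at `n + k`.
    have key : ∀ k : ℕ, (n + k + 1 ≤ N ω ∧ relRank X n (n + k) ω ≤ 2) ↔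
        k ∈ Finset.range (releaseTime X N n ω - n) := by
      intro k
      rw [Finset.mem_range]
      constructor
      · rintro ⟨h1, h2⟩
        by_contra hk
        have h3 : releaseTime X N n ω ≤ n + k := by omega
        rcases hmem.2 with h4 | h4
        · omega
        · have := relRank_mono X n ω h3
          simp only at this
          omega
      · intro hk
        have : n + k ∉ S := Nat.notMem_of_lt_sInf (show n + k < releaseTime X N n ω by omega)
        simp only [hS, Set.mem_ofPred_eq, not_and, not_or] at this
        have := this (by omega)
        omega
    simp_rw [key]
    rw [tsum_eq_sum (s := Finset.range (releaseTime X N n ω - n))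
      (fun k hk => if_neg hk), Finset.sum_congr rfl (fun k hk => if_pos hk)]
    simp
  · rw [Nat.cast_zero, eq_comm, ENNReal.tsum_eq_zero]
    intro k
    apply if_neg
    rintro ⟨h1, h2⟩
    have := relRank_mono X n ω (Nat.le_add_right n k)
    simp only at this
    exact h ⟨hn, by omega, by omega⟩

/-- An index attaining the running maximum at `n` has relative rank 1 at its own time, ties
included, because ranks count strict inequalities only. This makes the rule a function of the maxima
alone. -/
lemma thresholdTime_le_iff (c : ℝ) (n : ℕ) (ω : Ω) :
    thresholdTime X c ω ≤ (n : WithTop ℕ) ↔ 1 ≤ n ∧ c < runningMax X n ω := by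
  unfold thresholdTime
  split_ifs with h
  · rw [show ((sInf {n : ℕ | 1 ≤ n ∧ relRank X n n ω = 1 ∧ c < X n ω} : ℕ) : WithTop ℕ) ≤ n ↔
      sInf {n : ℕ | 1 ≤ n ∧ relRank X n n ω = 1 ∧ c < X n ω} ≤ n from Nat.cast_le]
    constructor
    · intro hle
      obtain ⟨h1, h2, h3⟩ := Nat.sInf_mem (s := {n : ℕ | 1 ≤ n ∧ relRank X n n ω = 1 ∧ c < X n ω}) h
      exact ⟨h1.trans hle, h3.trans_le (le_runningMax X h1 hle ω)⟩
    · rintro ⟨h1, h2⟩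
      obtain ⟨i, hi1, hi2, hi⟩ := exists_eq_runningMax X h1 ω
      refine le_trans (Nat.sInf_le ⟨hi1, ?_, hi ▸ h2⟩) hi2
      rw [relRank_eq_one_iff]
      intro j hj1 hj2
      rw [← hi]; exact le_runningMax X hj1 (hj2.trans hi2) ω
  · simp only [top_le_iff, WithTop.natCast_ne_top, false_iff, not_and]
    intro h1 h2
    obtain ⟨i, hi1, hi2, hi⟩ := exists_eq_runningMax X h1 ω
    refine h ⟨i, hi1, ?_, hi ▸ h2⟩
    rw [relRank_eq_one_iff]
    intro j hj1 hj2
    rw [← hi]; exact le_runningMax X hj1 (hj2.trans hi2) ω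

lemma thresholdTime_eq_coe {c : ℝ} {n : ℕ} {ω : Ω} (h : thresholdTime X c ω = (n : WithTop ℕ)) :
    1 ≤ n ∧ relRank X n n ω = 1 ∧ c < X n ω := by
  unfold thresholdTime at h
  split_ifs at h with h'
  · rw [← Nat.cast_injective (R := WithTop ℕ) h]
    exact Nat.sInf_mem (s := {n : ℕ | 1 ≤ n ∧ relRank X n n ω = 1 ∧ c < X n ω}) h'
  · exact absurd h.symm (WithTop.natCast_ne_top n)

lemma thresholdTime_le_of {c : ℝ} {n : ℕ} {ω : Ω} (hn : 1 ≤ n) (h : c < runningMax X n ω) :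
    thresholdTime X c ω ≤ (n : WithTop ℕ) := (thresholdTime_le_iff X c n ω).2 ⟨hn, h⟩

lemma one_le_thresholdTime (c : ℝ) (ω : Ω) : 1 ≤ thresholdTime X c ω := by
  cases h : thresholdTime X c ω with
  | top => exact le_top
  | coe n => exact Nat.one_le_cast.2 (thresholdTime_eq_coe X h).1

lemma dependsOnMaximaOnly_thresholdTime (c : ℝ) :
    DependsOnMaximaOnly X (thresholdTime X c) := by
  intro n
  simp_rw [thresholdTime_le_iff]
  rcases Nat.lt_or_ge n 1 with hn | hn
  · have : {ω : Ω | 1 ≤ n ∧ c < runningMax X n ω} = ∅ := by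
      ext ω; simp; omega
    rw [this]; exact MeasurableSpace.measurableSet_empty _
  · have : {ω : Ω | 1 ≤ n ∧ c < runningMax X n ω} = runningMax X n ⁻¹' Set.Ioi c := by
      ext ω; simp [hn]
    rw [this]
    exact le_iSup₂ (f := fun i (_ : i ∈ Finset.Icc 1 n) =>
      MeasurableSpace.comap (runningMax X i) inferInstance) n (Finset.mem_Icc.2 ⟨hn, le_rfl⟩) _
      ⟨_, measurableSet_Ioi, rfl⟩

end Pathwise

/-! ### Measurability with respect to the information filtration -/

section Measurability

lemma measurable_relRank_of {Ω : Type*} [MeasurableSpace Ω] {X : ℕ → Ω → ℝ} {j n : ℕ}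
    (hj : Measurable (X j)) (h : ∀ i, 1 ≤ i → i ≤ n → Measurable (X i)) :
    Measurable (relRank X j n) := by
  induction n with
  | zero =>
    have : relRank X j 0 = fun _ => 1 := by ext ω; simp [relRank]
    rw [this]; exact measurable_const
  | succ m ih =>
    have : relRank X j (m + 1) = fun ω => relRank X j m ω +
        if X j ω < X (m + 1) ω then 1 else 0 := by ext ω; exact relRank_succ X j m ω
    rw [this]
    refine Measurable.add (ih fun i h1 h2 => h i h1 (by omega))
      (Measurable.ite ?_ measurable_const measurable_const)
    exact measurableSet_lt hj (h _ (by omega) le_rfl)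

lemma measurable_runningMax_of {Ω : Type*} [MeasurableSpace Ω] {X : ℕ → Ω → ℝ} {n : ℕ}
    (hn : 1 ≤ n) (h : ∀ i, 1 ≤ i → i ≤ n → Measurable (X i)) :
    Measurable (runningMax X n) := by
  induction n, hn using Nat.le_induction with
  | base =>
    have : runningMax X 1 = X 1 := by ext ω; exact runningMax_one X ω
    rw [this]; exact h 1 le_rfl le_rfl
  | succ n hn ih =>
    have : runningMax X (n + 1) = fun ω => max (runningMax X n ω) (X (n + 1) ω) := by
      ext ω; exact runningMax_succ X hn ω
    rw [this]
    exact Measurable.max (ih fun i h1 h2 => h i h1 (by omega)) (h _ (by omega) le_rfl)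

/-- The sets that agree on `S` with a set measurable for `G`. -/
abbrev traceSpace {Ω : Type*} (G : MeasurableSpace Ω) (S : Set Ω) : MeasurableSpace Ω where
  MeasurableSet' A := ∃ B, MeasurableSet[G] B ∧ A ∩ S = B ∩ S
  measurableSet_empty := ⟨∅, @MeasurableSet.empty _ G, rfl⟩
  measurableSet_compl := by
    rintro A ⟨B, hB, h⟩
    refine ⟨Bᶜ, hB.compl, ?_⟩
    ext ω
    have := Set.ext_iff.1 h ω
    simp only [Set.mem_inter_iff, Set.mem_compl_iff] at this ⊢
    tauto
  measurableSet_iUnion := by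
    intro f hf
    choose g hg h using hf
    refine ⟨⋃ i, g i, MeasurableSet.iUnion hg, ?_⟩
    rw [Set.iUnion_inter, Set.iUnion_inter]
    exact Set.iUnion_congr h

variable {Ω : Type*} [mΩ : MeasurableSpace Ω] {X : ℕ → Ω → ℝ} {N : Ω → ℕ}
  (hX : ∀ n, 1 ≤ n → Measurable (X n)) (hN : Measurable N)

lemma measurable_value {j n : ℕ} (hj : 1 ≤ j) (hjn : j ≤ n) :
    Measurable[infoFiltration X N hX hN n] (X j) := by
  refine (comap_measurable (X j)).mono (le_trans ?_ le_sup_left) le_rfl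
  exact le_iSup₂ (f := fun i (_ : i ∈ Finset.Icc 1 n) =>
    MeasurableSpace.comap (X i) inferInstance) j (Finset.mem_Icc.2 ⟨hj, hjn⟩)

lemma measurable_relRank {j n : ℕ} (hj : 1 ≤ j) (hjn : j ≤ n) :
    Measurable[infoFiltration X N hX hN n] (relRank X j n) :=
  @measurable_relRank_of _ (infoFiltration X N hX hN n) _ _ _ (measurable_value hX hN hj hjn)
    fun _ h1 h2 => measurable_value hX hN h1 h2

lemma measurable_runningMax {n : ℕ} (hn : 1 ≤ n) :
    Measurable[infoFiltration X N hX hN n] (runningMax X n) :=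
  @measurable_runningMax_of _ (infoFiltration X N hX hN n) _ _ hn
    fun _ h1 h2 => measurable_value hX hN h1 h2

lemma thresholdTime_mem_strategies (c : ℝ) :
    thresholdTime X c ∈ strategies X N hX hN := by
  refine ⟨fun n => ?_, one_le_thresholdTime X c⟩
  change MeasurableSet[infoFiltration X N hX hN n] {ω | thresholdTime X c ω ≤ (n : WithTop ℕ)}
  simp_rw [thresholdTime_le_iff]
  rcases Nat.lt_or_ge n 1 with hn | hn
  · have : {ω : Ω | 1 ≤ n ∧ c < runningMax X n ω} = ∅ := by
      ext ω; simp; omega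
    rw [this]; exact MeasurableSpace.measurableSet_empty _
  · have : {ω : Ω | 1 ≤ n ∧ c < runningMax X n ω} = runningMax X n ⁻¹' Set.Ioi c := by
      ext ω; simp [hn]
    rw [this]
    exact measurable_runningMax hX hN hn measurableSet_Ioi

lemma thresholdTime_mem_bestOnlyStrategies (c : ℝ) :
    thresholdTime X c ∈ bestOnlyStrategies X N hX hN :=
  ⟨thresholdTime_mem_strategies hX hN c, fun _ _ h => (thresholdTime_eq_coe X h).2.1⟩

/-- As long as the horizon has not been passed, the information consists of the values alone. -/
lemma exists_inter_eq {n : ℕ} {A : Set Ω}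
    (hA : MeasurableSet[infoFiltration X N hX hN n] A) :
    ∃ B, MeasurableSet[⨆ i ∈ Finset.Icc 1 n, MeasurableSpace.comap (X i) inferInstance] B ∧
      A ∩ {ω | n ≤ N ω} = B ∩ {ω | n ≤ N ω} := by
  have hle : infoFiltration X N hX hN n ≤ traceSpace
      (⨆ i ∈ Finset.Icc 1 n, MeasurableSpace.comap (X i) inferInstance) {ω | n ≤ N ω} := by
    refine sup_le (fun A hA => ⟨A, hA, rfl⟩) (MeasurableSpace.generateFrom_le ?_)
    rintro A ⟨j, hj, rfl⟩
    -- For `j ≤ n` the event `j ≤ N` contains `n ≤ N`, so its trace there is everything.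
    refine ⟨Set.univ, MeasurableSet.univ, ?_⟩
    ext ω
    simp only [Set.mem_inter_iff, Set.mem_ofPred_eq, Set.mem_univ, true_and]
    omega
  exact hle A hA

end Measurability

/-! ### Values of holding, stopping and waiting -/

noncomputable section

/-- Expected remaining duration of a held object of value `x` that is second best. -/
def secondValue (p x : ℝ) : ℝ := (1 - p) / (1 - (1 - p) * x)

/-- Expected remaining duration of a held object of value `x` that is best. -/
def bestValue (p x : ℝ) : ℝ :=
  (1 - p) * (2 / (1 - (1 - p) * x) - p / (1 - (1 - p) * x) ^ 2)

/-- Expected remaining duration of a held object of value `x` and relative rank `r`. -/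
def holdValue (p : ℝ) (r : ℕ) (x : ℝ) : ℝ :=
  if r = 1 then bestValue p x else if r = 2 then secondValue p x else 0

/-- Optimal value when the running maximum is `x`, with threshold `s`. -/
def optValue (p s x : ℝ) : ℝ := bestValue p (max x s)

/-- Value of waiting for one more object when the running maximum is `x`. -/
def waitValue (p s x : ℝ) : ℝ :=
  (1 - p) * (x * optValue p s x + ∫ t in x..1, optValue p s t)

end

/-! ### Monotonicity, the threshold equation and one-step recursions -/

section Analysis

variable {p : ℝ}

lemma p_le_denom (hp1 : p < 1) {x : ℝ} (hx : x ≤ 1) : p ≤ 1 - (1 - p) * x := by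
  nlinarith

lemma denom_pos (hp0 : 0 < p) (hp1 : p < 1) {x : ℝ} (hx : x ≤ 1) : 0 < 1 - (1 - p) * x :=
  hp0.trans_le (p_le_denom hp1 hx)

/-- In terms of the denominator `u`, the function `2 / u - p / u ^ 2` is strictly decreasing for `u
≥ p`, which is exactly the range `x ≤ 1`; and `u` decreases in `x`. -/
lemma bestValue_strictMonoOn (hp0 : 0 < p) (hp1 : p < 1) :
    StrictMonoOn (bestValue p) (Set.Iic 1) := by
  intro x hx y hy hxy
  have hu := p_le_denom hp1 hx
  have hv := p_le_denom hp1 hy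
  unfold bestValue
  have huv : 1 - (1 - p) * y < 1 - (1 - p) * x := by nlinarith
  generalize 1 - (1 - p) * x = u at *
  generalize 1 - (1 - p) * y = v at *
  have hu0 : 0 < u := by linarith
  have hv0 : 0 < v := by linarith
  apply mul_lt_mul_of_pos_left _ (by linarith)
  rw [← sub_pos]
  have : 2 / v - p / v ^ 2 - (2 / u - p / u ^ 2) =
      (u - v) * (v * (u - p) + u * (v - p)) / (u ^ 2 * v ^ 2) := by
    field_simp; ring
  rw [this]
  have h1 : 0 ≤ v * (u - p) + u * (v - p) := by
    have := mul_nonneg hv0.le (sub_nonneg.2 hu)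
    have := mul_nonneg hu0.le (sub_nonneg.2 hv)
    linarith
  have h2 : 0 < v * (u - p) := mul_pos hv0 (by linarith)
  have h3 : 0 ≤ u * (v - p) := mul_nonneg hu0.le (by linarith)
  have h4 : 0 < u - v := by linarith
  positivity

lemma secondValue_strictMonoOn (hp0 : 0 < p) (hp1 : p < 1) :
    StrictMonoOn (secondValue p) (Set.Iic 1) := by
  intro x hx y hy hxy
  have hv := denom_pos hp0 hp1 hy
  unfold secondValue
  apply div_lt_div_of_pos_left (by linarith) hv
  nlinarith

lemma secondValue_le_bestValue (hp0 : 0 < p) (hp1 : p < 1) {x : ℝ} (hx : x ≤ 1) :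
    secondValue p x ≤ bestValue p x := by
  have hu := p_le_denom hp1 hx
  unfold bestValue secondValue
  generalize 1 - (1 - p) * x = u at *
  have hu0 : 0 < u := by linarith
  rw [← sub_nonneg]
  have : (1 - p) * (2 / u - p / u ^ 2) - (1 - p) / u = (1 - p) * (u - p) / u ^ 2 := by
    field_simp; ring
  rw [this]
  have : 0 ≤ 1 - p := by linarith
  have : 0 ≤ u - p := by linarith
  positivity

lemma secondValue_nonneg (hp0 : 0 < p) (hp1 : p < 1) {x : ℝ} (hx : x ≤ 1) :
    0 ≤ secondValue p x :=
  div_nonneg (by linarith) (denom_pos hp0 hp1 hx).le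

lemma bestValue_nonneg (hp0 : 0 < p) (hp1 : p < 1) {x : ℝ} (hx : x ≤ 1) :
    0 ≤ bestValue p x :=
  (secondValue_nonneg hp0 hp1 hx).trans (secondValue_le_bestValue hp0 hp1 hx)

lemma holdValue_nonneg (hp0 : 0 < p) (hp1 : p < 1) (r : ℕ) {x : ℝ} (hx : x ≤ 1) :
    0 ≤ holdValue p r x := by
  unfold holdValue
  split_ifs
  · exact bestValue_nonneg hp0 hp1 hx
  · exact secondValue_nonneg hp0 hp1 hx
  · exact le_rfl

/-- A bound uniform in rank and value, used to make the remainder of the telescoping sum vanish. -/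
lemma holdValue_le (hp0 : 0 < p) (hp1 : p < 1) (r : ℕ) {x : ℝ} (hx : x ≤ 1) :
    holdValue p r x ≤ bestValue p 1 := by
  have h := (bestValue_strictMonoOn hp0 hp1).monotoneOn hx (Set.mem_Iic.2 le_rfl) hx
  unfold holdValue
  split_ifs
  · exact h
  · exact (secondValue_le_bestValue hp0 hp1 hx).trans h
  · exact bestValue_nonneg hp0 hp1 le_rfl

/-- With probability `1 - p` the horizon survives one more step; a unit is then earned if the
current rank is at most 2, and the next value leaves the rank unchanged with probability `x` or
raises it by one. Ranks above 2 are worthless. -/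
lemma holdValue_recursion (hp0 : 0 < p) (hp1 : p < 1) {r : ℕ} (hr : 1 ≤ r) {x : ℝ} (hx : x ≤ 1) :
    holdValue p r x = (1 - p) * ((if r ≤ 2 then 1 else 0) + x * holdValue p r x +
      (1 - x) * holdValue p (r + 1) x) := by
  have hu : 1 - (1 - p) * x ≠ 0 := (denom_pos hp0 hp1 hx).ne'
  unfold holdValue
  rcases hr.eq_or_lt with rfl | hr
  · norm_num [bestValue, secondValue, -mul_eq_mul_left_iff]
    field_simp
    ring
  rcases (Nat.succ_le_of_lt hr).eq_or_lt with rfl | hr2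
  · norm_num [secondValue, -mul_eq_mul_left_iff]
    field_simp
    ring
  · simp only [Nat.succ_eq_add_one] at hr2
    rw [if_neg (by omega), if_neg (by omega), if_neg (by omega), if_neg (by omega),
      if_neg (by omega)]
    ring

lemma measurable_bestValue : Measurable (bestValue p) := by unfold bestValue; fun_prop

lemma measurable_secondValue : Measurable (secondValue p) := by unfold secondValue; fun_prop

lemma measurable_holdValue : Measurable fun z : ℝ × ℕ => holdValue p z.2 z.1 := by
  unfold holdValue
  refine Measurable.ite (measurable_snd (measurableSet_singleton 1))
    (measurable_bestValue.comp measurable_fst) ?_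
  exact Measurable.ite (measurable_snd (measurableSet_singleton 2))
    (measurable_secondValue.comp measurable_fst) measurable_const

lemma measurable_optValue (s : ℝ) : Measurable (optValue p s) :=
  measurable_bestValue.comp (measurable_id.max measurable_const)

lemma optValue_nonneg (hp0 : 0 < p) (hp1 : p < 1) {s x : ℝ} (hs : s ≤ 1) (hx : x ≤ 1) :
    0 ≤ optValue p s x := bestValue_nonneg hp0 hp1 (max_le hx hs)

lemma optValue_le (hp0 : 0 < p) (hp1 : p < 1) {s x : ℝ} (hs : s ≤ 1) (hx : x ≤ 1) :
    optValue p s x ≤ bestValue p 1 :=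
  (bestValue_strictMonoOn hp0 hp1).monotoneOn (max_le hx hs) (Set.mem_Iic.2 le_rfl) (max_le hx hs)

lemma bestValue_le_optValue (hp0 : 0 < p) (hp1 : p < 1) {s x : ℝ} (hs : s ≤ 1) (hx : x ≤ 1) :
    bestValue p x ≤ optValue p s x :=
  (bestValue_strictMonoOn hp0 hp1).monotoneOn hx (max_le hx hs) (le_max_left _ _)

/-- Holding a second best object is strictly worse than the optimal value. -/
lemma secondValue_lt_optValue (hp0 : 0 < p) (hp1 : p < 1) {s x y : ℝ} (hs : s ≤ 1) (hx : x ≤ 1)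
    (hyx : y < x) : secondValue p y < optValue p s x :=
  ((secondValue_strictMonoOn hp0 hp1 (hyx.le.trans hx) hx hyx).trans_le
    (secondValue_le_bestValue hp0 hp1 hx)).trans_le (bestValue_le_optValue hp0 hp1 hs hx)

lemma optValue_pos (hp0 : 0 < p) (hp1 : p < 1) {s x : ℝ} (hs : s ≤ 1) (hx : x ≤ 1) :
    0 < optValue p s x :=
  -- Any argument below `x` would do; it only serves to make the inequality strict.
  (secondValue_nonneg hp0 hp1 (x := x - 1) (by linarith)).trans_lt
    (secondValue_lt_optValue hp0 hp1 hs hx (by linarith))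

lemma continuousOn_bestValue (hp0 : 0 < p) (hp1 : p < 1) :
    ContinuousOn (bestValue p) (Set.Iic 1) := by
  intro x hx
  have hu : 1 - (1 - p) * x ≠ 0 := (denom_pos hp0 hp1 hx).ne'
  have : ContinuousAt (bestValue p) x := by
    unfold bestValue
    fun_prop (disch := first | exact hu | exact pow_ne_zero 2 hu)
  exact this.continuousWithinAt

lemma continuousOn_optValue (hp0 : 0 < p) (hp1 : p < 1) {s : ℝ} (hs : s ≤ 1) :
    ContinuousOn (optValue p s) (Set.Iic 1) :=
  (continuousOn_bestValue hp0 hp1).comp (by fun_prop) fun _ hx => max_le hx hs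

lemma intervalIntegrable_optValue (hp0 : 0 < p) (hp1 : p < 1) {s a b : ℝ} (hs : s ≤ 1)
    (ha : a ≤ 1) (hb : b ≤ 1) : IntervalIntegrable (optValue p s) volume a b :=
  ((continuousOn_optValue hp0 hp1 hs).mono fun _ ht => ht.2.trans (max_le ha hb)).intervalIntegrable

lemma integral_bestValue (hp0 : 0 < p) (hp1 : p < 1) {x : ℝ} (hx : x ≤ 1) :
    ∫ t in x..1, bestValue p t =
      2 * Real.log ((1 - (1 - p) * x) / p) + p / (1 - (1 - p) * x) - 1 := by
  have hd : ∀ t ∈ Set.uIcc x 1, HasDerivAt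
      (fun t => -2 * Real.log (1 - (1 - p) * t) - p * (1 - (1 - p) * t)⁻¹) (bestValue p t) t := by
    intro t ht
    rw [Set.uIcc_of_le hx] at ht
    have hu : 1 - (1 - p) * t ≠ 0 := (denom_pos hp0 hp1 ht.2).ne'
    have h1 : HasDerivAt (fun t => 1 - (1 - p) * t) (-(1 - p)) t := by
      simpa using ((hasDerivAt_id t).const_mul (1 - p)).const_sub 1
    have h2 := ((h1.log hu).const_mul (-2)).sub ((h1.inv hu).const_mul p)
    refine h2.congr_deriv ?_
    unfold bestValue
    field_simp
  rw [intervalIntegral.integral_eq_sub_of_hasDerivAt hd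
    (((continuousOn_bestValue hp0 hp1).mono
      fun _ ht => ht.2.trans (max_le hx le_rfl)).intervalIntegrable),
    Real.log_div (denom_pos hp0 hp1 hx).ne' hp0.ne']
  have : 1 - (1 - p) * 1 = p := by ring
  rw [this]
  field_simp
  ring

/-- The function whose value at the threshold ratio `μ` is `3 / 2`. -/
lemma log_add_inv_strictMonoOn : StrictMonoOn (fun r : ℝ => Real.log r + r⁻¹) (Set.Ici 1) := by
  apply strictMonoOn_of_deriv_pos (convex_Ici 1)
  · intro r hr
    have : r ≠ 0 := (zero_lt_one.trans_le hr).ne'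
    exact ((Real.continuousAt_log this).add (continuousAt_inv₀ this)).continuousWithinAt
  · intro r hr
    rw [interior_Ici] at hr
    have hr1 : 1 < r := hr
    have hr0 : r ≠ 0 := by linarith
    have := ((Real.hasDerivAt_log hr0).add (hasDerivAt_inv hr0)).deriv
    have h2 : deriv (fun r : ℝ => Real.log r + r⁻¹) r = r⁻¹ + -(r ^ 2)⁻¹ := this
    rw [h2]
    have h3 : r⁻¹ + -(r ^ 2)⁻¹ = (r - 1) / r ^ 2 := by field_simp; ring
    rw [h3]
    have : 0 < r - 1 := by linarith
    positivity

lemma sq_mul_exp_eq_iff {μ : ℝ} (hμ : 1 < μ) :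
    μ ^ 2 * Real.exp (2 / μ) = Real.exp 3 ↔ Real.log μ + μ⁻¹ = 3 / 2 := by
  have hμ0 : 0 < μ := by linarith
  have h : μ ^ 2 * Real.exp (2 / μ) = Real.exp (2 * (Real.log μ + μ⁻¹)) := by
    rw [mul_add, Real.exp_add, two_mul (Real.log μ), Real.exp_add, Real.exp_log hμ0]
    ring_nf
  rw [h, Real.exp_eq_exp]
  constructor <;> intro h <;> linarith

lemma existsUnique_ratio :
    ∃! μ : ℝ, 1 < μ ∧ μ ^ 2 * Real.exp (2 / μ) = Real.exp 3 := by
  have hc : ContinuousOn (fun r : ℝ => Real.log r + r⁻¹) (Set.Icc 1 (Real.exp 2)) := by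
    intro r hr
    have : r ≠ 0 := (zero_lt_one.trans_le hr.1).ne'
    exact ((Real.continuousAt_log this).add (continuousAt_inv₀ this)).continuousWithinAt
  have he : (1 : ℝ) ≤ Real.exp 2 := Real.one_le_exp (by norm_num)
  -- The function `log r + r⁻¹` is 1 at `r = 1` and exceeds 2 at `r = exp 2`.
  obtain ⟨μ, hμ, hμ2⟩ := intermediate_value_Icc he hc
    (show (3 / 2 : ℝ) ∈ Set.Icc _ _ from by
      constructor
      · norm_num
      · have := Real.exp_pos (-2)
        simp only [Real.log_exp, ← Real.exp_neg]
        linarith)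
  have hμ1 : 1 < μ := by
    refine lt_of_le_of_ne hμ.1 ?_
    rintro rfl
    norm_num at hμ2
  refine ⟨μ, ⟨hμ1, (sq_mul_exp_eq_iff hμ1).2 hμ2⟩, ?_⟩
  rintro ν ⟨hν1, hν⟩
  exact log_add_inv_strictMonoOn.injOn hν1.le hμ1.le (((sq_mul_exp_eq_iff hν1).1 hν).trans hμ2.symm)

lemma threshold_lt_one (hp0 : 0 < p) (hp1 : p < 1) {μ : ℝ} (hμ : 1 < μ) : threshold μ p < 1 := by
  refine max_lt one_pos ?_
  rw [div_lt_one_of_neg (by linarith)]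
  nlinarith

/-- Truncating the threshold at 0 can only raise it, hence lower the denominator. Equality holds
when the truncation is inactive. -/
lemma denom_threshold_le (hp1 : p < 1) (μ : ℝ) :
    1 - (1 - p) * threshold μ p ≤ μ * p := by
  have h : (μ * p - 1) / (p - 1) ≤ threshold μ p := le_max_right _ _
  rw [div_le_iff_of_neg (by linarith)] at h
  linarith

lemma denom_threshold_eq (hp1 : p < 1) {μ : ℝ} (h : 0 < threshold μ p) :
    1 - (1 - p) * threshold μ p = μ * p := by
  have h1 : threshold μ p = (μ * p - 1) / (p - 1) := by
    unfold threshold at *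
    rcases lt_max_iff.1 h with h | h
    · exact absurd h (lt_irrefl _)
    · exact max_eq_right h.le
  rw [h1]
  have : p - 1 ≠ 0 := by linarith
  field_simp
  ring

lemma optValue_of_le {s x : ℝ} (h : s ≤ x) : optValue p s x = bestValue p x := by
  rw [optValue, max_eq_left h]

lemma optValue_of_ge {s x : ℝ} (h : x ≤ s) : optValue p s x = bestValue p s := by
  rw [optValue, max_eq_right h]

lemma integral_optValue_of_le {s x : ℝ} (h : s ≤ x) (hx : x ≤ 1) :
    ∫ t in x..1, optValue p s t = ∫ t in x..1, bestValue p t := by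
  refine intervalIntegral.integral_congr fun t ht => ?_
  rw [Set.uIcc_of_le hx] at ht
  exact optValue_of_le (h.trans ht.1)

/-- Here `u * bestValue p x = (1 - p) * (2 - p / u)`, while the integral over larger values
contributes `2 * log (u / p) + p / u - 1`. Collecting terms leaves a function of the ratio `u / p`
alone. -/
lemma optValue_sub_waitValue (hp0 : 0 < p) (hp1 : p < 1) {s x : ℝ} (h : s ≤ x) (hx : x ≤ 1) :
    optValue p s x - waitValue p s x = (1 - p) * (3 - 2 *
      (Real.log ((1 - (1 - p) * x) / p) + ((1 - (1 - p) * x) / p)⁻¹)) := by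
  have hu := (denom_pos hp0 hp1 hx).ne'
  rw [waitValue, integral_optValue_of_le h hx, integral_bestValue hp0 hp1 hx, optValue_of_le h,
    inv_div]
  have : bestValue p x - (1 - p) * (x * bestValue p x + (2 * Real.log ((1 - (1 - p) * x) / p) +
      p / (1 - (1 - p) * x) - 1)) = (1 - (1 - p) * x) * bestValue p x -
      (1 - p) * (2 * Real.log ((1 - (1 - p) * x) / p) + p / (1 - (1 - p) * x) - 1) := by ring
  rw [this]
  unfold bestValue
  field_simp
  ring

/-- Above the threshold, waiting is strictly worse than the optimal value. -/
lemma waitValue_lt_optValue (hp0 : 0 < p) (hp1 : p < 1) {μ : ℝ} (hμ : 1 < μ)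
    (hμ2 : μ ^ 2 * Real.exp (2 / μ) = Real.exp 3) {x : ℝ} (h : threshold μ p < x) (hx : x ≤ 1) :
    waitValue p (threshold μ p) x < optValue p (threshold μ p) x := by
  rw [← sub_pos, optValue_sub_waitValue hp0 hp1 h.le hx]
  have h1 : 1 ≤ (1 - (1 - p) * x) / p := (one_le_div hp0).2 (p_le_denom hp1 hx)
  have h2 : (1 - (1 - p) * x) / p < μ := by
    rw [div_lt_iff₀ hp0]
    refine lt_of_lt_of_le ?_ (denom_threshold_le hp1 μ)
    nlinarith
  have h3 := log_add_inv_strictMonoOn h1 (h1.trans h2.le) h2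
  have h4 := (sq_mul_exp_eq_iff hμ).1 hμ2
  simp only at h3
  apply mul_pos (by linarith)
  linarith

/-- Below the threshold, waiting is optimal. -/
lemma waitValue_eq_optValue (hp0 : 0 < p) (hp1 : p < 1) {μ : ℝ} (hμ : 1 < μ)
    (hμ2 : μ ^ 2 * Real.exp (2 / μ) = Real.exp 3) {x : ℝ} (hx0 : 0 < x)
    (h : x ≤ threshold μ p) :
    waitValue p (threshold μ p) x = optValue p (threshold μ p) x := by
  have hs1 := (threshold_lt_one hp0 hp1 hμ).le
  have h0 := optValue_sub_waitValue hp0 hp1 (le_refl (threshold μ p)) hs1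
  -- Since `0 < x ≤ s`, the threshold is not truncated: the ratio at `s` is exactly `μ`, so stopping
  -- and waiting tie there.
  rw [denom_threshold_eq hp1 (hx0.trans_le h), mul_div_cancel_right₀ _ hp0.ne',
    (sq_mul_exp_eq_iff hμ).1 hμ2] at h0
  set s := threshold μ p
  -- The value is constant up to `s`, so the value of waiting at `x` equals that at `s`.
  have h1 : ∫ t in x..s, optValue p s t = (s - x) * bestValue p s := by
    rw [intervalIntegral.integral_congr (g := fun _ => bestValue p s)]
    · simp
    · intro t ht
      rw [Set.uIcc_of_le h] at ht
      exact optValue_of_ge ht.2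
  have h2 := intervalIntegral.integral_add_adjacent_intervals
    (intervalIntegrable_optValue hp0 hp1 hs1 (h.trans hs1) hs1)
    (intervalIntegrable_optValue hp0 hp1 (a := s) hs1 hs1 le_rfl)
  unfold waitValue at h0 ⊢
  rw [← h2, h1, optValue_of_ge h]
  rw [optValue_of_ge le_rfl] at h0
  linarith

lemma waitValue_le_optValue (hp0 : 0 < p) (hp1 : p < 1) {μ : ℝ} (hμ : 1 < μ)
    (hμ2 : μ ^ 2 * Real.exp (2 / μ) = Real.exp 3) {x : ℝ} (hx0 : 0 < x) (hx : x ≤ 1) :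
    waitValue p (threshold μ p) x ≤ optValue p (threshold μ p) x := by
  rcases le_or_gt x (threshold μ p) with h | h
  · exact (waitValue_eq_optValue hp0 hp1 hμ hμ2 hx0 h).le
  · exact (waitValue_lt_optValue hp0 hp1 hμ hμ2 h hx).le

lemma waitValue_nonneg (hp0 : 0 < p) (hp1 : p < 1) {s x : ℝ} (hs : s ≤ 1) (hx0 : 0 ≤ x)
    (hx : x ≤ 1) : 0 ≤ waitValue p s x := by
  refine mul_nonneg (by linarith) (add_nonneg (mul_nonneg hx0 (optValue_nonneg hp0 hp1 hs hx)) ?_)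
  exact intervalIntegral.integral_nonneg hx fun t ht => optValue_nonneg hp0 hp1 hs ht.2

lemma lintegral_unit_split {f : ℝ → ENNReal} {x : ℝ} (hx0 : 0 ≤ x) (hx : x ≤ 1) :
    ∫⁻ t in Set.Icc (0 : ℝ) 1, f t =
      (∫⁻ t in Set.Icc 0 x, f t) + ∫⁻ t in Set.Ioc x 1, f t := by
  rw [← Set.Icc_union_Ioc_eq_Icc hx0 hx, lintegral_union measurableSet_Ioc]
  rw [Set.disjoint_left]
  exact fun t h1 h2 => absurd h1.2 (not_le.2 h2.1)

/-- One step of the optimal value function. -/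
lemma lintegral_optValue_max (hp0 : 0 < p) (hp1 : p < 1) {s x : ℝ} (hs : s ≤ 1) (hx0 : 0 ≤ x)
    (hx : x ≤ 1) :
    ENNReal.ofReal (1 - p) * ∫⁻ t in Set.Icc (0 : ℝ) 1, ENNReal.ofReal (optValue p s (max x t)) =
      ENNReal.ofReal (waitValue p s x) := by
  have h1 : ∫⁻ t in Set.Icc 0 x, ENNReal.ofReal (optValue p s (max x t)) =
      ENNReal.ofReal (x * optValue p s x) := by
    rw [setLIntegral_congr_fun (g := fun _ => ENNReal.ofReal (optValue p s x)) measurableSet_Icc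
      (fun t ht => by simp only; rw [max_eq_left ht.2])]
    rw [setLIntegral_const, Real.volume_Icc, sub_zero, mul_comm, ← ENNReal.ofReal_mul hx0]
  have h2 : ∫⁻ t in Set.Ioc x 1, ENNReal.ofReal (optValue p s (max x t)) =
      ENNReal.ofReal (∫ t in x..1, optValue p s t) := by
    rw [setLIntegral_congr_fun (g := fun t => ENNReal.ofReal (optValue p s t)) measurableSet_Ioc
      (fun t ht => by simp only; rw [max_eq_right ht.1.le]), intervalIntegral.integral_of_le hx,
      ofReal_integral_eq_lintegral_ofReal
        (intervalIntegrable_optValue hp0 hp1 hs hx le_rfl).1]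
    exact (ae_restrict_mem measurableSet_Ioc).mono fun t ht => optValue_nonneg hp0 hp1 hs ht.2
  rw [lintegral_unit_split hx0 hx, h1, h2, ← ENNReal.ofReal_add
    (mul_nonneg hx0 (optValue_nonneg hp0 hp1 hs hx))
    (intervalIntegral.integral_nonneg hx fun t ht => optValue_nonneg hp0 hp1 hs ht.2),
    ← ENNReal.ofReal_mul (by linarith)]
  rfl

/-- One step of the value of a held object. -/
lemma lintegral_holdValue (hp0 : 0 < p) (hp1 : p < 1) {r : ℕ} (hr : 1 ≤ r) {x : ℝ} (hx0 : 0 ≤ x)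
    (hx : x ≤ 1) :
    ENNReal.ofReal (1 - p) * ∫⁻ t in Set.Icc (0 : ℝ) 1, ((if r ≤ 2 then 1 else 0) +
        ENNReal.ofReal (holdValue p (r + if x < t then 1 else 0) x)) =
      ENNReal.ofReal (holdValue p r x) := by
  have h1 : ∫⁻ t in Set.Icc 0 x, ENNReal.ofReal (holdValue p (r + if x < t then 1 else 0) x) =
      ENNReal.ofReal (x * holdValue p r x) := by
    rw [setLIntegral_congr_fun (g := fun _ => ENNReal.ofReal (holdValue p r x)) measurableSet_Icc
      (fun t ht => by simp only; rw [if_neg (not_lt.2 ht.2), add_zero])]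
    rw [setLIntegral_const, Real.volume_Icc, sub_zero, mul_comm, ← ENNReal.ofReal_mul hx0]
  have h2 : ∫⁻ t in Set.Ioc x 1, ENNReal.ofReal (holdValue p (r + if x < t then 1 else 0) x) =
      ENNReal.ofReal ((1 - x) * holdValue p (r + 1) x) := by
    rw [setLIntegral_congr_fun (g := fun _ => ENNReal.ofReal (holdValue p (r + 1) x))
      measurableSet_Ioc (fun t ht => by simp only; rw [if_pos ht.1])]
    rw [setLIntegral_const, Real.volume_Ioc, mul_comm, ← ENNReal.ofReal_mul (by linarith)]
  have h3 : (if r ≤ 2 then 1 else 0 : ENNReal) = ENNReal.ofReal (if r ≤ 2 then 1 else 0) := by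
    split_ifs <;> simp
  have h4 := mul_nonneg hx0 (holdValue_nonneg hp0 hp1 r hx)
  have h5 := mul_nonneg (sub_nonneg.2 hx) (holdValue_nonneg hp0 hp1 (r + 1) hx)
  rw [lintegral_add_left measurable_const, setLIntegral_const, Real.volume_Icc, sub_zero,
    ENNReal.ofReal_one, mul_one, lintegral_unit_split hx0 hx, h1, h2, h3,
    ← ENNReal.ofReal_add h4 h5, ← ENNReal.ofReal_add (by split_ifs <;> norm_num) (by linarith),
    ← ENNReal.ofReal_mul (by linarith), ← add_assoc, ← holdValue_recursion hp0 hp1 hr hx]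

end Analysis

/-! ### The probabilistic model and its one-step transition -/

/-- Independent uniform values with an independent geometric horizon. -/
structure GeometricModel {Ω : Type*} [MeasurableSpace Ω] (P : Measure Ω) (p : ℝ) (X : ℕ → Ω → ℝ)
    (N : Ω → ℕ) : Prop where
  pos : 0 < p
  lt_one : p < 1
  measX : ∀ n, 1 ≤ n → Measurable (X n)
  indepX : iIndepFun (fun i : ℕ => X (i + 1)) P
  unif : ∀ n, 1 ≤ n → P.map (X n) = volume.restrict (Set.Icc (0 : ℝ) 1)
  measN : Measurable N
  geom : ∀ k : ℕ, 1 ≤ k → P {ω | N ω = k} = ENNReal.ofReal (p * (1 - p) ^ (k - 1))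
  indepN : IndepFun N (fun ω (i : ℕ) => X (i + 1) ω) P

namespace GeometricModel

variable {Ω : Type*} [MeasurableSpace Ω] {P : Measure Ω} {p : ℝ}
  {X : ℕ → Ω → ℝ} {N : Ω → ℕ} (h : GeometricModel P p X N)

include h

/-- Shifting the geometric weights by one multiplies each of them by `1 - p`: the horizon is
memoryless. -/
lemma measure_horizon_succ {n : ℕ} (hn : 1 ≤ n) :
    P {ω | n + 1 ≤ N ω} = ENNReal.ofReal (1 - p) * P {ω | n ≤ N ω} := by
  have key : ∀ m : ℕ, P {ω | m ≤ N ω} = ∑' k : ℕ, P {ω | N ω = m + k} := by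
    intro m
    rw [← measure_iUnion]
    · congr 1
      ext ω
      simp only [Set.mem_ofPred_eq, Set.mem_iUnion]
      exact le_iff_exists_add
    · intro i j hij
      rw [Function.onFun, Set.disjoint_left]
      intro ω h1 h2
      simp only [Set.mem_ofPred_eq] at h1 h2
      omega
    · exact fun k => h.measN (measurableSet_singleton (m + k))
  rw [key, key, ← ENNReal.tsum_mul_left]
  refine tsum_congr fun k => ?_
  rw [h.geom _ (by omega), h.geom _ (by omega), ← ENNReal.ofReal_mul (by linarith [h.lt_one])]
  congr 1
  obtain ⟨m, hm⟩ : ∃ m, n + k = m + 1 := ⟨n + k - 1, by omega⟩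
  rw [show n + 1 + k - 1 = m + 1 by omega, show n + k - 1 = m by omega, pow_succ]
  ring

lemma ae_value_mem_Ioo {n : ℕ} (hn : 1 ≤ n) : ∀ᵐ ω ∂P, X n ω ∈ Set.Ioo (0 : ℝ) 1 := by
  have h1 : ∀ᵐ x ∂(P.map (X n)), x ∈ Set.Ioo (0 : ℝ) 1 := by
    rw [h.unif n hn, ← restrict_Ioo_eq_restrict_Icc]
    exact ae_restrict_mem measurableSet_Ioo
  exact ae_of_ae_map (h.measX n hn).aemeasurable h1

lemma ae_value_ne {n : ℕ} (hn : 1 ≤ n) (c : ℝ) : ∀ᵐ ω ∂P, X n ω ≠ c := by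
  have h1 : ∀ᵐ x ∂(P.map (X n)), x ≠ c := by
    rw [h.unif n hn]
    exact ae_restrict_of_ae (Measure.ae_ne volume c)
  exact ae_of_ae_map (h.measX n hn).aemeasurable h1

lemma ae_forall_value_mem_Ioo : ∀ᵐ ω ∂P, ∀ n, 1 ≤ n → X n ω ∈ Set.Ioo (0 : ℝ) 1 := by
  rw [ae_all_iff]
  intro n
  by_cases hn : 1 ≤ n
  · exact (h.ae_value_mem_Ioo hn).mono fun _ h _ => h
  · exact ae_of_all _ fun _ h => absurd h hn

/-- The event `m ≤ N`, the values up to time `n` and the next value are independent. -/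
lemma measure_inter_next {n m : ℕ} {B : Set Ω} {C : Set ℝ}
    (hB : MeasurableSet[⨆ i ∈ Finset.Icc 1 n, MeasurableSpace.comap (X i) inferInstance] B)
    (hC : MeasurableSet C) :
    P ({ω | m ≤ N ω} ∩ (B ∩ X (n + 1) ⁻¹' C)) =
      P {ω | m ≤ N ω} * (P B * volume.restrict (Set.Icc (0 : ℝ) 1) C) := by
  have hle : ∀ i, MeasurableSpace.comap (X (i + 1)) inferInstance ≤
      MeasurableSpace.comap (fun ω (i : ℕ) => X (i + 1) ω) MeasurableSpace.pi := by
    rintro i _ ⟨C, hC, rfl⟩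
    exact ⟨(fun f => f i) ⁻¹' C, measurable_pi_apply i hC, rfl⟩
  have hG : (⨆ i ∈ Finset.Icc 1 n, MeasurableSpace.comap (X i) inferInstance) ≤
      ⨆ i ∈ Set.Iio n, MeasurableSpace.comap (X (i + 1)) inferInstance := by
    refine iSup₂_le fun i hi => ?_
    obtain ⟨h1, h2⟩ := Finset.mem_Icc.1 hi
    obtain ⟨j, rfl⟩ : ∃ j, i = j + 1 := ⟨i - 1, by omega⟩
    exact le_iSup₂ (f := fun i (_ : i ∈ Set.Iio n) =>
      MeasurableSpace.comap (X (i + 1)) inferInstance) j (Set.mem_Iio.2 h2)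
  have hG' : (⨆ i ∈ Set.Iio n, MeasurableSpace.comap (X (i + 1)) inferInstance) ≤
      MeasurableSpace.comap (fun ω (i : ℕ) => X (i + 1) ω) MeasurableSpace.pi :=
    iSup₂_le fun i _ => hle i
  have h1 := (Indep_iff _ _ _).1 ((IndepFun_iff_Indep _ _ _).1 h.indepN) {ω | m ≤ N ω}
    (B ∩ X (n + 1) ⁻¹' C) ⟨Set.Ici m, measurableSet_Ici, rfl⟩
    (MeasurableSet.inter (hG' _ (hG _ hB)) (hle n _ ⟨C, hC, rfl⟩))
  -- In the shifted indexing the first `n` values have indices below `n` and the next value has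
  -- index `n`; these index sets are disjoint.
  have h2 := indep_iSup_of_disjoint (fun i => (h.measX (i + 1) (by omega)).comap_le) h.indepX
    (S := Set.Iio n) (T := {n}) (by simp)
  have h3 := (Indep_iff _ _ _).1 h2 B (X (n + 1) ⁻¹' C) (hG _ hB)
    (le_iSup₂ (f := fun i (_ : i ∈ ({n} : Set ℕ)) =>
      MeasurableSpace.comap (X (i + 1)) inferInstance) n rfl _ ⟨C, hC, rfl⟩)
  rw [h1, h3, ← h.unif (n + 1) (by omega), Measure.map_apply (h.measX _ (by omega)) hC]

lemma measure_next {n : ℕ} (hn : 1 ≤ n) {A : Set Ω} {C : Set ℝ}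
    (hA : MeasurableSet[infoFiltration X N h.measX h.measN n] A) (hC : MeasurableSet C) :
    P (A ∩ {ω | n + 1 ≤ N ω} ∩ X (n + 1) ⁻¹' C) = ENNReal.ofReal (1 - p) *
      P (A ∩ {ω | n ≤ N ω}) * volume.restrict (Set.Icc (0 : ℝ) 1) C := by
  obtain ⟨B, hB, hAB⟩ := exists_inter_eq h.measX h.measN hA
  have e1 : A ∩ {ω | n + 1 ≤ N ω} ∩ X (n + 1) ⁻¹' C =
      {ω | n + 1 ≤ N ω} ∩ (B ∩ X (n + 1) ⁻¹' C) := by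
    ext ω
    have := Set.ext_iff.1 hAB ω
    have hlt : n + 1 ≤ N ω → n ≤ N ω := fun h => by omega
    simp only [Set.mem_inter_iff, Set.mem_ofPred_eq] at this ⊢
    tauto
  have e2 : A ∩ {ω | n ≤ N ω} = {ω | n ≤ N ω} ∩ (B ∩ X (n + 1) ⁻¹' Set.univ) := by
    rw [hAB, Set.preimage_univ, Set.inter_univ, Set.inter_comm]
  rw [e1, e2, h.measure_inter_next hB hC, h.measure_inter_next hB MeasurableSet.univ,
    h.measure_horizon_succ hn]
  simp
  ring

variable [IsProbabilityMeasure P]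

lemma measure_horizon_le (n : ℕ) : P {ω | n + 1 ≤ N ω} ≤ ENNReal.ofReal (1 - p) ^ n := by
  induction n with
  | zero => simpa using prob_le_one
  | succ n ih =>
    rw [h.measure_horizon_succ (by omega), pow_succ']
    gcongr

lemma tendsto_measure_horizon :
    Filter.Tendsto (fun n => P {ω | n + 1 ≤ N ω}) Filter.atTop (nhds 0) := by
  refine tendsto_of_tendsto_of_tendsto_of_le_of_le tendsto_const_nhds
    (ENNReal.tendsto_pow_atTop_nhds_zero_of_lt_one ?_) (fun _ => zero_le) h.measure_horizon_le
  rw [ENNReal.ofReal_lt_one]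
  linarith [h.pos]

/-- One step of the process: the next value is uniform and the horizon survives with probability
`1 - p`. -/
lemma lintegral_next {E : Type*} [MeasurableSpace E] {n : ℕ} (hn : 1 ≤ n) {A : Set Ω}
    (hA : MeasurableSet[infoFiltration X N h.measX h.measN n] A) {Z : Ω → E}
    (hZ : Measurable[infoFiltration X N h.measX h.measN n] Z) {f : E × ℝ → ENNReal}
    (hf : Measurable f) :
    ∫⁻ ω in A ∩ {ω | n + 1 ≤ N ω}, f (Z ω, X (n + 1) ω) ∂P =
      ∫⁻ ω in A ∩ {ω | n ≤ N ω},
        (ENNReal.ofReal (1 - p) * ∫⁻ t in Set.Icc (0 : ℝ) 1, f (Z ω, t)) ∂P := by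
  have hZ' : Measurable Z := hZ.mono ((infoFiltration X N h.measX h.measN).le n) le_rfl
  have hX' : Measurable (X (n + 1)) := h.measX _ (by omega)
  have hmap : (P.restrict (A ∩ {ω | n + 1 ≤ N ω})).map (fun ω => (Z ω, X (n + 1) ω)) =
      (ENNReal.ofReal (1 - p) • (P.restrict (A ∩ {ω | n ≤ N ω})).map Z).prod
        (volume.restrict (Set.Icc (0 : ℝ) 1)) := by
    symm
    have : IsFiniteMeasure (ENNReal.ofReal (1 - p) • (P.restrict (A ∩ {ω | n ≤ N ω})).map Z) :=
      Measure.smul_finite _ ENNReal.ofReal_ne_top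
    refine Measure.prod_eq fun D C hD hC => ?_
    have hAm := (infoFiltration X N h.measX h.measN).le n _ hA
    rw [Measure.map_apply (hZ'.prodMk hX') (hD.prod hC), Measure.smul_apply,
      Measure.map_apply hZ' hD, Measure.restrict_apply (hZ' hD),
      Measure.restrict_apply ((hZ'.prodMk hX') (hD.prod hC)), smul_eq_mul]
    have := h.measure_next hn (MeasurableSet.inter hA (hZ hD)) hC
    convert this using 2
    · ext ω; simp only [Set.mem_inter_iff, Set.mem_preimage, Set.mem_prod]; tauto
    · congr 2
      ext ω; simp only [Set.mem_inter_iff]; tauto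
  rw [← lintegral_map (f := f) (g := fun ω => (Z ω, X (n + 1) ω)) hf (hZ'.prodMk hX'), hmap,
    lintegral_prod _ hf.aemeasurable, lintegral_smul_measure,
    lintegral_map hf.lintegral_prod_right' hZ', smul_eq_mul, lintegral_const_mul]
  exact hf.lintegral_prod_right'.comp hZ'

end GeometricModel

/-- Stated with sums rather than differences, so that no finiteness is needed; the vanishing
remainder closes the series. -/
lemma eq_tsum_of_telescope {u d : ℕ → ENNReal} (h : ∀ k, u k = d k + u (k + 1))
    (hu : Filter.Tendsto u Filter.atTop (nhds 0)) : u 0 = ∑' k, d k := by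
  have h1 : ∀ k, u 0 = (∑ i ∈ Finset.range k, d i) + u k := by
    intro k
    induction k with
    | zero => simp
    | succ k ih => rw [Finset.sum_range_succ, add_assoc, ← h k, ih]
  have h2 := (ENNReal.tendsto_nat_tsum d).add hu
  simp_rw [← h1, add_zero] at h2
  exact tendsto_nhds_unique tendsto_const_nhds h2

/-! ### Expected duration of a strategy -/

namespace GeometricModel

variable {Ω : Type*} [MeasurableSpace Ω] {P : Measure Ω} {p : ℝ}
  {X : ℕ → Ω → ℝ} {N : Ω → ℕ} (h : GeometricModel P p X N)

include h

lemma measurableSet_horizon (n : ℕ) : MeasurableSet {ω | n ≤ N ω} := h.measN measurableSet_Ici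

lemma measurable_relRank_self {n m : ℕ} (hn : 1 ≤ n) : Measurable (relRank X n m) :=
  measurable_relRank_of (h.measX n hn) fun i hi _ => h.measX i hi

lemma measurable_max {n : ℕ} (hn : 1 ≤ n) : Measurable (runningMax X n) :=
  measurable_runningMax_of hn fun i hi _ => h.measX i hi

lemma measurable_hold {n m : ℕ} (hn : 1 ≤ n) :
    Measurable fun ω => ENNReal.ofReal (holdValue p (relRank X n m ω) (X n ω)) :=
  (measurable_holdValue.comp ((h.measX n hn).prodMk (h.measurable_relRank_self hn))).ennreal_ofReal

lemma ae_forall_max_mem_Ioo : ∀ᵐ ω ∂P, ∀ n, 1 ≤ n → runningMax X n ω ∈ Set.Ioo (0 : ℝ) 1 := by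
  filter_upwards [h.ae_forall_value_mem_Ioo] with ω hω n hn
  obtain ⟨i, hi, _, hi2⟩ := exists_eq_runningMax X hn ω
  exact hi2 ▸ hω i hi

lemma measurableSet_stop_eq {τ : Ω → WithTop ℕ} (hτ : τ ∈ strategies X N h.measX h.measN)
    (n : ℕ) : MeasurableSet[infoFiltration X N h.measX h.measN n] {ω | τ ω = n} :=
  hτ.1.measurableSet_eq n

lemma measurableSet_stop_gt {τ : Ω → WithTop ℕ} (hτ : τ ∈ strategies X N h.measX h.measN)
    (n : ℕ) : MeasurableSet[infoFiltration X N h.measX h.measN n] {ω | (n : WithTop ℕ) < τ ω} :=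
  hτ.1.measurableSet_gt n

variable [IsProbabilityMeasure P]

/-- A bounded integrand is integrated over events on which the horizon survives ever longer, and
these have geometrically small probability. -/
lemma tendsto_setLIntegral {c : ENNReal} (hc : c ≠ ⊤) (n : ℕ) {S : ℕ → Set Ω}
    {f : ℕ → Ω → ENNReal} (hf : ∀ k, ∀ᵐ ω ∂P, f k ω ≤ c) :
    Filter.Tendsto (fun k => ∫⁻ ω in S k ∩ {ω | n + 1 + k ≤ N ω}, f k ω ∂P) Filter.atTop
      (nhds 0) := by
  have h1 : Filter.Tendsto (fun k => c * P {ω | k + n + 1 ≤ N ω}) Filter.atTop (nhds 0) := by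
    have := (Filter.tendsto_add_atTop_iff_nat n).2 h.tendsto_measure_horizon
    simpa using ENNReal.Tendsto.const_mul this (Or.inr hc)
  refine tendsto_of_tendsto_of_tendsto_of_le_of_le tendsto_const_nhds h1 (fun _ => zero_le)
    fun k => ?_
  calc ∫⁻ ω in S k ∩ {ω | n + 1 + k ≤ N ω}, f k ω ∂P
      ≤ ∫⁻ ω in S k ∩ {ω | n + 1 + k ≤ N ω}, c ∂P := lintegral_mono_ae (ae_restrict_of_ae (hf k))
    _ = c * P (S k ∩ {ω | n + 1 + k ≤ N ω}) := setLIntegral_const _ _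
    _ ≤ c * P {ω | k + n + 1 ≤ N ω} := by
        gcongr
        intro ω hω
        have : n + 1 + k ≤ N ω := hω.2
        change k + n + 1 ≤ N ω
        omega

/-- The expected duration of holding object `n` from time `n` on, on an event known at time `n`. -/
lemma setLIntegral_hold {n : ℕ} (hn : 1 ≤ n) {A : Set Ω}
    (hA : MeasurableSet[infoFiltration X N h.measX h.measN n] A) :
    ∫⁻ ω in A ∩ {ω | n ≤ N ω}, ENNReal.ofReal (holdValue p (relRank X n n ω) (X n ω)) ∂P =
      ∑' k, ∫⁻ ω in A ∩ {ω | n + k + 1 ≤ N ω}, (if relRank X n (n + k) ω ≤ 2 then 1 else 0) ∂P := by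
  obtain ⟨m, rfl⟩ : ∃ m, n = m + 1 := ⟨n - 1, by omega⟩
  refine eq_tsum_of_telescope (u := fun k => ∫⁻ ω in A ∩ {ω | m + 1 + k ≤ N ω},
    ENNReal.ofReal (holdValue p (relRank X (m + 1) (m + 1 + k) ω) (X (m + 1) ω)) ∂P)
    (fun k => ?_) ?_
  · have hZ : Measurable[infoFiltration X N h.measX h.measN (m + 1 + k)]
        (fun ω => (X (m + 1) ω, relRank X (m + 1) (m + 1 + k) ω)) :=
      (measurable_value h.measX h.measN hn (by omega)).prodMk
        (measurable_relRank h.measX h.measN hn (by omega))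
    have hm1 : Measurable fun z : (ℝ × ℕ) × ℝ => (if z.1.2 ≤ 2 then 1 else 0 : ENNReal) :=
      Measurable.ite ((measurable_snd.comp measurable_fst) measurableSet_Iic)
        measurable_const measurable_const
    have hm2 : Measurable fun z : (ℝ × ℕ) × ℝ =>
        ENNReal.ofReal (holdValue p (z.1.2 + if z.1.1 < z.2 then 1 else 0) z.1.1) := by
      refine (measurable_holdValue.comp ((measurable_fst.comp measurable_fst).prodMk
        (Measurable.add (measurable_snd.comp measurable_fst) (Measurable.ite ?_
          measurable_const measurable_const)))).ennreal_ofReal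
      exact measurableSet_lt (measurable_fst.comp measurable_fst) measurable_snd
    have := h.lintegral_next (n := m + 1 + k) (by omega)
      ((infoFiltration X N h.measX h.measN).mono (by omega) _ hA) hZ (hm1.add hm2)
    simp only [Pi.add_apply] at this
    -- The one-step recursion needs values in the unit interval, hence holds only almost surely.
    have e1 : ∫⁻ ω in A ∩ {ω | m + 1 + k ≤ N ω},
        ENNReal.ofReal (holdValue p (relRank X (m + 1) (m + 1 + k) ω) (X (m + 1) ω)) ∂P = _ :=
      lintegral_congr_ae (ae_restrict_of_ae (h.ae_forall_value_mem_Ioo.mono fun ω hω =>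
        (lintegral_holdValue h.pos h.lt_one (one_le_relRank X (m + 1) (m + 1 + k) ω)
          (hω (m + 1) hn).1.le (hω (m + 1) hn).2.le).symm))
    have hm3 : Measurable fun ω => (if relRank X (m + 1) (m + 1 + k) ω ≤ 2 then 1 else 0 : ENNReal) :=
      Measurable.ite (h.measurable_relRank_self hn measurableSet_Iic)
        measurable_const measurable_const
    rw [e1, ← this, lintegral_add_left hm3]
    simp_rw [← relRank_succ]
    rfl
  · refine h.tendsto_setLIntegral (c := ENNReal.ofReal (bestValue p 1)) ENNReal.ofReal_ne_top m
      (S := fun _ => A) fun k => ?_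
    filter_upwards [h.ae_value_mem_Ioo hn] with ω hω
    exact ENNReal.ofReal_le_ofReal (holdValue_le h.pos h.lt_one _ hω.2.le)

/-- Splitting by the stopping time, whose level sets are known when it occurs, allows the duration
to be replaced by its conditional expectation, the hold value. Stopping after the horizon
contributes nothing. -/
lemma expectedDuration_eq_tsum {τ : Ω → WithTop ℕ} (hτ : τ ∈ strategies X N h.measX h.measN) :
    expectedDuration P X N τ = ∑' n : ℕ, ∫⁻ ω in {ω | τ ω = (n + 1 : ℕ)} ∩ {ω | n + 1 ≤ N ω},
      ENNReal.ofReal (holdValue p (relRank X (n + 1) (n + 1) ω) (X (n + 1) ω)) ∂P := by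
  let D : ℕ → ℕ → Ω → ENNReal := fun n k => Set.indicator {ω | n + 1 + k + 1 ≤ N ω}
    (fun ω => if relRank X (n + 1) (n + 1 + k) ω ≤ 2 then 1 else 0)
  have hD : ∀ n k, Measurable (D n k) := fun n k =>
    (Measurable.ite (h.measurable_relRank_self (by omega) measurableSet_Iic)
      measurable_const measurable_const).indicator (h.measurableSet_horizon _)
  have hτm : ∀ n : ℕ, MeasurableSet {ω | τ ω = (n + 1 : ℕ)} := fun n =>
    (infoFiltration X N h.measX h.measN).le _ _ (h.measurableSet_stop_eq hτ (n + 1))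
  have hdur : ∀ n ω, (duration X N (n + 1) ω : ENNReal) = ∑' k, D n k ω := by
    intro n ω
    rw [duration_eq_tsum X N (by omega)]
    refine tsum_congr fun k => ?_
    by_cases hk : n + 1 + k + 1 ≤ N ω
    · rw [show D n k ω = _ from Set.indicator_of_mem (s := {ω | n + 1 + k + 1 ≤ N ω}) hk _]
      simp [hk]
    · rw [show D n k ω = _ from Set.indicator_of_notMem (s := {ω | n + 1 + k + 1 ≤ N ω}) hk _]
      simp [hk]
  have hpt : ∀ ω, (if τ ω = ⊤ then 0 else (duration X N ((τ ω).untopD 0) ω : ENNReal)) =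
      ∑' n : ℕ, Set.indicator {ω | τ ω = (n + 1 : ℕ)} (fun ω => ∑' k, D n k ω) ω := by
    intro ω
    have h1 := hτ.2 ω
    cases hω : τ ω with
    | top =>
      rw [if_pos rfl, eq_comm, ENNReal.tsum_eq_zero]
      intro n
      refine Set.indicator_of_notMem ?_ _
      rw [Set.mem_ofPred_eq, hω]
      exact (WithTop.natCast_ne_top _).symm
    | coe m =>
      rw [hω] at h1
      have hm : 1 ≤ m := Nat.one_le_cast.1 h1
      obtain ⟨n, rfl⟩ : ∃ n, m = n + 1 := ⟨m - 1, by omega⟩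
      rw [if_neg WithTop.coe_ne_top, WithTop.untopD_coe, hdur]
      symm
      rw [tsum_eq_single n]
      · exact Set.indicator_of_mem (s := {ω | τ ω = (n + 1 : ℕ)}) hω _
      · intro k hk
        refine Set.indicator_of_notMem (fun hk2 => hk ?_) _
        have h2 : ((n + 1 : ℕ) : WithTop ℕ) = ((k + 1 : ℕ) : WithTop ℕ) := hω.symm.trans hk2
        have := Nat.cast_injective h2
        omega
  unfold expectedDuration
  simp_rw [hpt]
  rw [lintegral_tsum fun n =>
    ((Measurable.tsum (hD n)).indicator (hτm n)).aemeasurable]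
  refine tsum_congr fun n => ?_
  rw [lintegral_indicator (hτm n), lintegral_tsum fun k => (hD n k).aemeasurable,
    h.setLIntegral_hold (by omega) (h.measurableSet_stop_eq hτ (n + 1))]
  refine tsum_congr fun k => ?_
  rw [setLIntegral_indicator (h.measurableSet_horizon _), Set.inter_comm]

end GeometricModel

/-! ### Losses, optimality and uniqueness -/

noncomputable section

/-- Loss incurred by stopping at an object of rank `r` and value `x` when the maximum is `m`. -/
def stopLoss (p s : ℝ) (r : ℕ) (x m : ℝ) : ENNReal :=
  ENNReal.ofReal (optValue p s m) - ENNReal.ofReal (holdValue p r x)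

/-- Loss incurred by waiting when the maximum is `m`. -/
def waitLoss (p s m : ℝ) : ENNReal :=
  ENNReal.ofReal (optValue p s m) - ENNReal.ofReal (1 - p) *
    ∫⁻ t in Set.Icc (0 : ℝ) 1, ENNReal.ofReal (optValue p s (max m t))

end

lemma measurable_waitLoss (p s : ℝ) : Measurable (waitLoss p s) := by
  have : Measurable fun z : ℝ × ℝ => ENNReal.ofReal (optValue p s (max z.1 z.2)) :=
    ((measurable_optValue s).comp (measurable_fst.max measurable_snd)).ennreal_ofReal
  exact (measurable_optValue s).ennreal_ofReal.sub (this.lintegral_prod_right'.const_mul _)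

lemma holdValue_le_optValue {p s x m : ℝ} {r : ℕ} (hp0 : 0 < p) (hp1 : p < 1) (hs : s ≤ 1)
    (hm : m ≤ 1) (hxm : x ≤ m) : holdValue p r x ≤ optValue p s m := by
  have hx : x ≤ 1 := hxm.trans hm
  have h1 := ((bestValue_strictMonoOn hp0 hp1).monotoneOn hx hm hxm).trans
    (bestValue_le_optValue hp0 hp1 hs hm)
  unfold holdValue
  split_ifs
  · exact h1
  · exact (secondValue_le_bestValue hp0 hp1 hx).trans h1
  · exact optValue_nonneg hp0 hp1 hs hm

namespace GeometricModel

variable {Ω : Type*} [MeasurableSpace Ω] {P : Measure Ω} {p : ℝ}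
  {X : ℕ → Ω → ℝ} {N : Ω → ℕ} (h : GeometricModel P p X N)

include h

lemma measurable_stopLoss (s : ℝ) {n : ℕ} (hn : 1 ≤ n) :
    Measurable fun ω => stopLoss p s (relRank X n n ω) (X n ω) (runningMax X n ω) :=
  ((measurable_optValue s).comp (h.measurable_max hn)).ennreal_ofReal.sub (h.measurable_hold hn)

lemma measurable_waitLoss_max (s : ℝ) {n : ℕ} (hn : 1 ≤ n) :
    Measurable fun ω => waitLoss p s (runningMax X n ω) :=
  (measurable_waitLoss p s).comp (h.measurable_max hn)

variable [IsProbabilityMeasure P]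

/-- Waiting for one more object, on an event known at time `n`. -/
lemma setLIntegral_wait {s : ℝ} {n : ℕ} (hn : 1 ≤ n) {A : Set Ω}
    (hA : MeasurableSet[infoFiltration X N h.measX h.measN n] A) :
    ∫⁻ ω in A ∩ {ω | n + 1 ≤ N ω}, ENNReal.ofReal (optValue p s (runningMax X (n + 1) ω)) ∂P =
      ∫⁻ ω in A ∩ {ω | n ≤ N ω}, (ENNReal.ofReal (1 - p) * ∫⁻ t in Set.Icc (0 : ℝ) 1,
        ENNReal.ofReal (optValue p s (max (runningMax X n ω) t))) ∂P := by
  have hf : Measurable fun z : ℝ × ℝ => ENNReal.ofReal (optValue p s (max z.1 z.2)) :=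
    ((measurable_optValue s).comp (measurable_fst.max measurable_snd)).ennreal_ofReal
  rw [← h.lintegral_next hn hA (measurable_runningMax h.measX h.measN hn) hf]
  simp_rw [runningMax_succ X hn]

/-- The optimal value splits into the expected duration of a strategy and the losses incurred by
stopping and by waiting at the wrong times. -/
theorem optimal_eq_expectedDuration_add {μ : ℝ} (hμ : 1 < μ)
    (hμ2 : μ ^ 2 * Real.exp (2 / μ) = Real.exp 3) {τ : Ω → WithTop ℕ}
    (hτ : τ ∈ strategies X N h.measX h.measN) :
    ∫⁻ ω in {ω | 1 ≤ N ω}, ENNReal.ofReal (optValue p (threshold μ p) (runningMax X 1 ω)) ∂P =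
      expectedDuration P X N τ + ∑' n : ℕ,
        ((∫⁻ ω in {ω | τ ω = (n + 1 : ℕ)} ∩ {ω | n + 1 ≤ N ω}, stopLoss p (threshold μ p)
          (relRank X (n + 1) (n + 1) ω) (X (n + 1) ω) (runningMax X (n + 1) ω) ∂P) +
        ∫⁻ ω in {ω | ((n + 1 : ℕ) : WithTop ℕ) < τ ω} ∩ {ω | n + 1 ≤ N ω},
          waitLoss p (threshold μ p) (runningMax X (n + 1) ω) ∂P) := by
  have hs := (threshold_lt_one h.pos h.lt_one hμ).le
  set s := threshold μ p with hs_def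
  rw [h.expectedDuration_eq_tsum hτ, ← ENNReal.tsum_add]
  have hle := (infoFiltration X N h.measX h.measN).le
  -- Strategies take values at least 1, so nothing has been stopped at time 0.
  have hfirst : {ω | 1 ≤ N ω} = {ω | ((0 : ℕ) : WithTop ℕ) < τ ω} ∩ {ω | 0 + 1 ≤ N ω} := by
    ext ω
    have : ((0 : ℕ) : WithTop ℕ) < τ ω := lt_of_lt_of_le (by norm_num) (hτ.2 ω)
    simpa using fun _ => this
  rw [hfirst]
  refine eq_tsum_of_telescope (u := fun n => ∫⁻ ω in {ω | (n : WithTop ℕ) < τ ω} ∩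
    {ω | n + 1 ≤ N ω}, ENNReal.ofReal (optValue p s (runningMax X (n + 1) ω)) ∂P)
    (fun n => ?_) ?_
  · have hn : 1 ≤ n + 1 := by omega
    have hsplit : {ω | (n : WithTop ℕ) < τ ω} ∩ {ω | n + 1 ≤ N ω} =
        ({ω | τ ω = (n + 1 : ℕ)} ∩ {ω | n + 1 ≤ N ω}) ∪
        ({ω | ((n + 1 : ℕ) : WithTop ℕ) < τ ω} ∩ {ω | n + 1 ≤ N ω}) := by
      rw [← Set.union_inter_distrib_right]
      congr 1
      ext ω
      simp only [Set.mem_ofPred_eq, Set.mem_union]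
      cases τ ω with
      | top => simp [WithTop.natCast_lt_top]
      | coe m =>
        have e1 : ((n : ℕ) : WithTop ℕ) < (m : WithTop ℕ) ↔ n < m := Nat.cast_lt
        have e2 : (m : WithTop ℕ) = ((n + 1 : ℕ) : WithTop ℕ) ↔ m = n + 1 := Nat.cast_inj
        have e3 : ((n + 1 : ℕ) : WithTop ℕ) < (m : WithTop ℕ) ↔ n + 1 < m := Nat.cast_lt
        change (n : WithTop ℕ) < (m : WithTop ℕ) ↔ (m : WithTop ℕ) = ((n + 1 : ℕ) : WithTop ℕ) ∨
          ((n + 1 : ℕ) : WithTop ℕ) < (m : WithTop ℕ)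
        rw [e1, e2, e3]
        omega
    have hm2 : MeasurableSet ({ω | ((n + 1 : ℕ) : WithTop ℕ) < τ ω} ∩ {ω | n + 1 ≤ N ω}) :=
      (hle _ _ (h.measurableSet_stop_gt hτ (n + 1))).inter (h.measurableSet_horizon _)
    have hdisj : Disjoint ({ω | τ ω = (n + 1 : ℕ)} ∩ {ω | n + 1 ≤ N ω})
        ({ω | ((n + 1 : ℕ) : WithTop ℕ) < τ ω} ∩ {ω | n + 1 ≤ N ω}) := by
      rw [Set.disjoint_left]
      intro ω h1 h2
      exact h2.1.ne h1.1.symm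
    have hsplit_loss : ∫⁻ ω in {ω | τ ω = (n + 1 : ℕ)} ∩ {ω | n + 1 ≤ N ω},
        ENNReal.ofReal (optValue p s (runningMax X (n + 1) ω)) ∂P =
        (∫⁻ ω in {ω | τ ω = (n + 1 : ℕ)} ∩ {ω | n + 1 ≤ N ω},
          ENNReal.ofReal (holdValue p (relRank X (n + 1) (n + 1) ω) (X (n + 1) ω)) ∂P) +
        ∫⁻ ω in {ω | τ ω = (n + 1 : ℕ)} ∩ {ω | n + 1 ≤ N ω}, stopLoss p s
          (relRank X (n + 1) (n + 1) ω) (X (n + 1) ω) (runningMax X (n + 1) ω) ∂P := by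
      rw [← lintegral_add_left (h.measurable_hold hn)]
      refine lintegral_congr_ae (ae_restrict_of_ae ?_)
      filter_upwards [h.ae_forall_max_mem_Ioo] with ω hω
      -- The truncated subtraction in the loss is exact because no stopping reward exceeds the
      -- optimal value.
      exact (add_tsub_cancel_of_le (ENNReal.ofReal_le_ofReal (holdValue_le_optValue h.pos h.lt_one
        hs (hω _ hn).2.le (le_runningMax X hn le_rfl ω)))).symm
    have hwait : ∫⁻ ω in {ω | ((n + 1 : ℕ) : WithTop ℕ) < τ ω} ∩ {ω | n + 1 ≤ N ω},
        ENNReal.ofReal (optValue p s (runningMax X (n + 1) ω)) ∂P =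
        (∫⁻ ω in {ω | ((n + 1 : ℕ) : WithTop ℕ) < τ ω} ∩ {ω | n + 1 ≤ N ω},
          waitLoss p s (runningMax X (n + 1) ω) ∂P) +
        ∫⁻ ω in {ω | ((n + 1 : ℕ) : WithTop ℕ) < τ ω} ∩ {ω | n + 1 + 1 ≤ N ω},
          ENNReal.ofReal (optValue p s (runningMax X (n + 1 + 1) ω)) ∂P := by
      rw [h.setLIntegral_wait hn (h.measurableSet_stop_gt hτ (n + 1)), ← lintegral_add_left
        (h.measurable_waitLoss_max s hn)]
      refine lintegral_congr_ae (ae_restrict_of_ae ?_)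
      filter_upwards [h.ae_forall_max_mem_Ioo] with ω hω
      obtain ⟨h1, h2⟩ := hω _ hn
      refine (tsub_add_cancel_of_le ?_).symm
      rw [lintegral_optValue_max h.pos h.lt_one hs h1.le h2.le]
      exact ENNReal.ofReal_le_ofReal (waitValue_le_optValue h.pos h.lt_one hμ hμ2 h1 h2.le)
    rw [hsplit, lintegral_union hm2 hdisj, hsplit_loss, hwait]
    simp only [add_assoc]
  · have := h.tendsto_setLIntegral (c := ENNReal.ofReal (bestValue p 1)) ENNReal.ofReal_ne_top 0
      (S := fun n => {ω | (n : WithTop ℕ) < τ ω})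
      (f := fun n ω => ENNReal.ofReal (optValue p s (runningMax X (n + 1) ω))) fun n => by
        filter_upwards [h.ae_forall_max_mem_Ioo] with ω hω
        exact ENNReal.ofReal_le_ofReal (optValue_le h.pos h.lt_one hs (hω _ (by omega)).2.le)
    simpa only [zero_add, Nat.add_comm 1] using this

/-- Finiteness is what permits cancelling the optimal value in the balance to conclude that the
losses vanish. -/
lemma optimal_ne_top {μ : ℝ} (hμ : 1 < μ) :
    ∫⁻ ω in {ω | 1 ≤ N ω}, ENNReal.ofReal (optValue p (threshold μ p) (runningMax X 1 ω)) ∂P ≠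
      ⊤ := by
  refine ne_top_of_le_ne_top (b := ENNReal.ofReal (bestValue p 1) * P {ω | 1 ≤ N ω})
    (ENNReal.mul_ne_top ENNReal.ofReal_ne_top (measure_ne_top _ _)) ?_
  rw [← setLIntegral_const]
  refine lintegral_mono_ae (ae_restrict_of_ae ?_)
  filter_upwards [h.ae_forall_max_mem_Ioo] with ω hω
  exact ENNReal.ofReal_le_ofReal (optValue_le h.pos h.lt_one
    (threshold_lt_one h.pos h.lt_one hμ).le (hω 1 le_rfl).2.le)

lemma expectedDuration_le {μ : ℝ} (hμ : 1 < μ)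
    (hμ2 : μ ^ 2 * Real.exp (2 / μ) = Real.exp 3) {τ : Ω → WithTop ℕ}
    (hτ : τ ∈ strategies X N h.measX h.measN) :
    expectedDuration P X N τ ≤
      ∫⁻ ω in {ω | 1 ≤ N ω}, ENNReal.ofReal (optValue p (threshold μ p) (runningMax X 1 ω)) ∂P := by
  rw [h.optimal_eq_expectedDuration_add hμ hμ2 hτ]
  exact le_self_add

/-- Every loss vanishes: the rule stops at a relative maximum above the threshold, where `V` is the
hold value, and waits only while the maximum is at most the threshold, where waiting attains `V`. -/
lemma expectedDuration_thresholdTime {μ : ℝ} (hμ : 1 < μ)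
    (hμ2 : μ ^ 2 * Real.exp (2 / μ) = Real.exp 3) :
    expectedDuration P X N (thresholdTime X (threshold μ p)) =
      ∫⁻ ω in {ω | 1 ≤ N ω}, ENNReal.ofReal (optValue p (threshold μ p) (runningMax X 1 ω)) ∂P := by
  have hτ := thresholdTime_mem_strategies h.measX h.measN (threshold μ p)
  have hs := (threshold_lt_one h.pos h.lt_one hμ).le
  rw [h.optimal_eq_expectedDuration_add hμ hμ2 hτ, eq_comm]
  convert add_zero _
  rw [ENNReal.tsum_eq_zero]
  intro n
  have hle := (infoFiltration X N h.measX h.measN).le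
  have hn : 1 ≤ n + 1 := by omega
  rw [add_eq_zero]
  constructor
  · rw [setLIntegral_congr_fun (g := fun _ => 0)
      ((hle _ _ (h.measurableSet_stop_eq hτ (n + 1))).inter (h.measurableSet_horizon _))]
    · exact lintegral_zero
    · rintro ω ⟨hω, -⟩
      obtain ⟨-, h1, h2⟩ := thresholdTime_eq_coe X hω
      have h3 := (relRank_self_eq_one_iff X hn).1 h1
      simp only [stopLoss]
      rw [h1, ← h3, optValue_of_le h2.le, holdValue, if_pos rfl, tsub_self]
  · rw [setLIntegral_congr_fun_ae (g := fun _ => 0)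
      ((hle _ _ (h.measurableSet_stop_gt hτ (n + 1))).inter (h.measurableSet_horizon _))]
    · exact lintegral_zero
    · filter_upwards [h.ae_forall_max_mem_Ioo] with ω hω hω2
      obtain ⟨h1, h2⟩ := hω _ hn
      have h3 : runningMax X (n + 1) ω ≤ threshold μ p := by
        by_contra hlt
        exact absurd hω2.1 (not_lt.2 (thresholdTime_le_of X hn (not_le.1 hlt)))
      rw [waitLoss, lintegral_optValue_max h.pos h.lt_one hs h1.le h2.le,
        waitValue_eq_optValue h.pos h.lt_one hμ hμ2 h1 h3, tsub_self]

theorem isOptimal_thresholdTime {μ : ℝ} (hμ : 1 < μ)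
    (hμ2 : μ ^ 2 * Real.exp (2 / μ) = Real.exp 3) :
    IsOptimal P X N (strategies X N h.measX h.measN) (thresholdTime X (threshold μ p)) :=
  ⟨thresholdTime_mem_strategies h.measX h.measN _, fun _ hσ =>
    (h.expectedDuration_le hμ hμ2 hσ).trans_eq (h.expectedDuration_thresholdTime hμ hμ2).symm⟩

/-- An optimal strategy almost surely incurs no loss. -/
lemma ae_no_loss {μ : ℝ} (hμ : 1 < μ) (hμ2 : μ ^ 2 * Real.exp (2 / μ) = Real.exp 3)
    {τ : Ω → WithTop ℕ} (hτ : IsOptimal P X N (strategies X N h.measX h.measN) τ) :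
    ∀ᵐ ω ∂P, ∀ n : ℕ, n + 1 ≤ N ω →
      (τ ω = (n + 1 : ℕ) → optValue p (threshold μ p) (runningMax X (n + 1) ω) ≤
        holdValue p (relRank X (n + 1) (n + 1) ω) (X (n + 1) ω)) ∧
      (((n + 1 : ℕ) : WithTop ℕ) < τ ω → optValue p (threshold μ p) (runningMax X (n + 1) ω) ≤
        waitValue p (threshold μ p) (runningMax X (n + 1) ω)) := by
  have hs := (threshold_lt_one h.pos h.lt_one hμ).le
  have hle := (infoFiltration X N h.measX h.measN).le
  have h1 := h.optimal_eq_expectedDuration_add hμ hμ2 hτ.1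
  have h2 : expectedDuration P X N τ = _ := le_antisymm (h.expectedDuration_le hμ hμ2 hτ.1)
    ((h.expectedDuration_thresholdTime hμ hμ2).symm.trans_le
      (hτ.2 _ (thresholdTime_mem_strategies h.measX h.measN _)))
  rw [h2] at h1
  have h3 := (ENNReal.add_right_inj (h.optimal_ne_top hμ)).1 (h1.symm.trans (add_zero _).symm)
  rw [ENNReal.tsum_eq_zero] at h3
  rw [ae_all_iff]
  intro n
  have hn : 1 ≤ n + 1 := by omega
  obtain ⟨h4, h5⟩ := add_eq_zero.1 (h3 n)
  rw [lintegral_eq_zero_iff (h.measurable_stopLoss _ hn), Filter.EventuallyEq, ae_restrict_iff'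
    ((hle _ _ (h.measurableSet_stop_eq hτ.1 (n + 1))).inter (h.measurableSet_horizon _))] at h4
  rw [lintegral_eq_zero_iff (h.measurable_waitLoss_max _ hn),
    Filter.EventuallyEq, ae_restrict_iff'
    ((hle _ _ (h.measurableSet_stop_gt hτ.1 (n + 1))).inter (h.measurableSet_horizon _))] at h5
  filter_upwards [h4, h5, h.ae_forall_max_mem_Ioo, h.ae_value_mem_Ioo hn] with ω h6 h7 h8 h9 hN
  obtain ⟨h10, h11⟩ := h8 _ hn
  refine ⟨fun h12 => ?_, fun h12 => ?_⟩
  · have := tsub_eq_zero_iff_le.1 (h6 ⟨h12, hN⟩)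
    exact (ENNReal.ofReal_le_ofReal_iff (holdValue_nonneg h.pos h.lt_one _ h9.2.le)).1 this
  · have := tsub_eq_zero_iff_le.1 (h7 ⟨h12, hN⟩)
    rw [lintegral_optValue_max h.pos h.lt_one hs h10.le h11.le] at this
    exact (ENNReal.ofReal_le_ofReal_iff (waitValue_nonneg h.pos h.lt_one hs h10.le h11.le)).1 this

/-- Absence of loss gives two comparisons: a stop within the horizon cannot precede the threshold
time, and a strategy cannot wait past a threshold time that lies within the horizon. -/
theorem ae_eq_thresholdTime {μ : ℝ} (hμ : 1 < μ)
    (hμ2 : μ ^ 2 * Real.exp (2 / μ) = Real.exp 3)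
    {τ : Ω → WithTop ℕ} (hτ : IsOptimal P X N (strategies X N h.measX h.measN) τ) :
    ∀ᵐ ω ∂P, (τ ω ≤ (N ω : WithTop ℕ) ∨
      thresholdTime X (threshold μ p) ω ≤ (N ω : WithTop ℕ)) →
        τ ω = thresholdTime X (threshold μ p) ω := by
  have hs := (threshold_lt_one h.pos h.lt_one hμ).le
  have hne : ∀ᵐ ω ∂P, ∀ n : ℕ, X (n + 1) ω ≠ threshold μ p :=
    ae_all_iff.2 fun n => h.ae_value_ne (by omega) _
  filter_upwards [h.ae_no_loss hμ hμ2 hτ, h.ae_forall_max_mem_Ioo, hne] with ω hω hmax hne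
  have key1 : τ ω ≤ (N ω : WithTop ℕ) → thresholdTime X (threshold μ p) ω ≤ τ ω := by
    intro hle
    have h1 := hτ.1.2 ω
    cases hτω : τ ω with
    | top => exact le_top
    | coe m =>
      rw [hτω] at h1 hle
      have hm : 1 ≤ m := Nat.one_le_cast.1 h1
      have hmN : m ≤ N ω := Nat.cast_le.1 hle
      obtain ⟨n, rfl⟩ : ∃ n, m = n + 1 := ⟨m - 1, by omega⟩
      have hloss := (hω n hmN).1 hτω
      have hM := (hmax (n + 1) hm).2.le
      have hXM := le_runningMax X hm le_rfl ω
      refine thresholdTime_le_of X hm ?_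
      unfold holdValue at hloss
      split_ifs at hloss with hr1 hr2
      · rw [← (relRank_self_eq_one_iff X hm).1 hr1] at hM hloss ⊢
        -- Zero loss only gives the weak inequality; equality with the threshold is a null event.
        refine lt_of_le_of_ne ?_ (hne n).symm
        exact le_of_max_le_right
          (((bestValue_strictMonoOn h.pos h.lt_one).le_iff_le (max_le hM hs) hM).1 hloss)
      · refine absurd hloss (not_le.2 (secondValue_lt_optValue h.pos h.lt_one hs hM
          (lt_of_le_of_ne hXM fun heq => hr1 ((relRank_self_eq_one_iff X hm).2 heq))))
      · exact absurd hloss (not_le.2 (optValue_pos h.pos h.lt_one hs hM))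
  have key2 : thresholdTime X (threshold μ p) ω ≤ (N ω : WithTop ℕ) →
      τ ω ≤ thresholdTime X (threshold μ p) ω := by
    intro hle
    cases hτω : thresholdTime X (threshold μ p) ω with
    | top => exact le_top
    | coe m =>
      rw [hτω] at hle
      have hmN : m ≤ N ω := Nat.cast_le.1 hle
      obtain ⟨hm, -, h2⟩ := thresholdTime_eq_coe X hτω
      obtain ⟨n, rfl⟩ : ∃ n, m = n + 1 := ⟨m - 1, by omega⟩
      by_contra hlt
      exact absurd ((hω n hmN).2 (not_le.1 hlt)) (not_le.2 (waitValue_lt_optValue h.pos h.lt_one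
        hμ hμ2 (h2.trans_le (le_runningMax X hm le_rfl ω)) (hmax (n + 1) hm).2.le))
  rintro (hle | hle)
  -- Each hypothesis yields the other: the comparison it allows brings the second time within the
  -- horizon too.
  · exact le_antisymm (key2 ((key1 hle).trans hle)) (key1 hle)
  · exact le_antisymm (key2 hle) (key1 ((key2 hle).trans hle))

end GeometricModel

end BestTwoDuration

theorem mainTheorem6 {Ω : Type*} [MeasurableSpace Ω] (P : Measure Ω) [IsProbabilityMeasure P]
    (p : ℝ) (hp0 : 0 < p) (hp1 : p < 1)
    (X : ℕ → Ω → ℝ) (hX : ∀ n, 1 ≤ n → Measurable (X n))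
    (hXindep : iIndepFun (fun i : ℕ => X (i + 1)) P)
    (hXunif : ∀ n, 1 ≤ n → P.map (X n) = volume.restrict (Set.Icc (0 : ℝ) 1))
    (N : Ω → ℕ) (hN : Measurable N)
    (hNgeom : ∀ k : ℕ, 1 ≤ k → P {ω | N ω = k} = ENNReal.ofReal (p * (1 - p) ^ (k - 1)))
    (hNX : IndepFun N (fun ω (i : ℕ) => X (i + 1) ω) P) :
    (∃! μ : ℝ, 1 < μ ∧ μ ^ 2 * Real.exp (2 / μ) = Real.exp 3) ∧
    ∀ μ : ℝ, 1 < μ → μ ^ 2 * Real.exp (2 / μ) = Real.exp 3 →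
      IsOptimal P X N (strategies X N hX hN) (thresholdTime X (threshold μ p)) ∧
      (∀ τ : Ω → WithTop ℕ, IsOptimal P X N (strategies X N hX hN) τ →
        ∀ᵐ ω ∂P, (τ ω ≤ (N ω : WithTop ℕ) ∨
          thresholdTime X (threshold μ p) ω ≤ (N ω : WithTop ℕ)) →
            τ ω = thresholdTime X (threshold μ p) ω) ∧
      DependsOnMaximaOnly X (thresholdTime X (threshold μ p)) ∧
      IsOptimal P X N (bestOnlyStrategies X N hX hN) (thresholdTime X (threshold μ p)) ∧
      (⨆ τ ∈ strategies X N hX hN, expectedDuration P X N τ) =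
        ⨆ τ ∈ bestOnlyStrategies X N hX hN, expectedDuration P X N τ := by
  have h : GeometricModel P p X N := ⟨hp0, hp1, hX, hXindep, hXunif, hN, hNgeom, hNX⟩
  refine ⟨existsUnique_ratio, fun μ hμ hμ2 => ?_⟩
  have hopt := h.isOptimal_thresholdTime hμ hμ2
  have hmem := thresholdTime_mem_bestOnlyStrategies hX hN (threshold μ p)
  refine ⟨hopt, fun τ hτ => h.ae_eq_thresholdTime hμ hμ2 hτ,
    dependsOnMaximaOnly_thresholdTime X _, ⟨hmem, fun σ hσ => hopt.2 σ hσ.1⟩, le_antisymm ?_ ?_⟩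
  · exact iSup₂_le fun σ hσ => (hopt.2 σ hσ).trans
      (le_iSup₂ (f := fun τ (_ : τ ∈ bestOnlyStrategies X N hX hN) => expectedDuration P X N τ)
        _ hmem)
  · exact biSup_mono fun σ hσ => hσ.1
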